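/- Let $K\subset\mathbb R^2$ be a compact convex set with support function $p(\varphi)=\max_{x\in K}\langle x,N(\varphi)\rangle$, $N(\varphi)=(\cos\varphi,\sin\varphi)$. Assume that $K$ is strictly convex with boundary $\Gamma$ of class $C^2$, in the sense that $p$ is of class $C^2$ and $p+p''>0$ everywhere, and that $K$ has constant width (its orthogonal projections on all directions have the same length). Let $F$ be the area of $K$, $L$ the length of $\Gamma$, and $\Delta=L^2-4\pi F$. Let $F_e$ be the area with multiplicities of the evolute of $\Gamma$, the closed curve with generalized support function $f(\theta)=p'(\theta-\pi/2)$, that is, $F_e=\frac12\int_0^{2\pi}(f^2-f'^2)\,d\theta$. For $P\notin K$ let $\omega=\omega(P)$ be the angle between the two tangents from $P$ to $\Gamma$. Then the integral below converges absolutely and $$\frac49\pi|F_e|-\Delta\ \ge\ \frac{64}{9}\int_{P\notin K}\Bigl(\omega-2\sin\omega+\sin2\omega-\tfrac14\sin4\omega-\sin^3\omega\Bigr)\,dP .$$ The right-hand side is strictly positive if $\frac49\pi|F_e|-\Delta\ne0$, and it is $0$ if $\frac49\pi|F_e|-\Delta=0$. Equality holds if and only if $K$ is a disk, or $K$ is bounded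 by a curve parallel to a Steiner curve (hypocycloid with three cusps), or $K$ is bounded by a curve parallel to a hypocycloid with five cusps, or $K$ is a Minkowski sum of finitely many domains of these types. Here a closed curve has the $2\pi$-periodic $C^2$ function $f$ as generalized support function if it is the envelope $f(\theta)N(\theta)+f'(\theta)N'(\theta)$ of the lines $x\cos\theta+y\sin\theta=f(\theta)$, and its parallel curves are those with generalized support functions $f+d$, $d\in\mathbb R$. A hypocycloid with $m$ cusps is a curve traced by a point of a circle of radius $r>0$ rolling inside a circle of radius $kr$, where $k=m/n>2$ in lowest terms (so $k=3$ for $m=3$; for $m=5$ the one with a $2\pi$-periodic generalized support function has $k=5/2$), in arbitrary position. The domains in the Minkowski sum are disks and domains bounded by curves parallel to hypocycloids with three or five cusps; they need not be convex, and Minkowski sum means that the support function of $K$ is the sum of their generalized support functions. -/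

import Mathlib

noncomputable section

namespace HurwitzWidth

open MeasureTheory

/-- The Euclidean plane. -/
abbrev Plane : Type := EuclideanSpace ℝ (Fin 2)

/-- The unit vector `N(φ) = (cos φ, sin φ)`. -/
def dirN (φ : ℝ) : Plane := !₂[Real.cos φ, Real.sin φ]

/-- Its derivative `N'(φ) = (-sin φ, cos φ)`. -/
def dirT (φ : ℝ) : Plane := !₂[-Real.sin φ, Real.cos φ]

/-- The support function `p(φ) = sup {⟨x, N(φ)⟩ : x ∈ K}` of a set `K`. -/
def supportFun (K : Set Plane) (φ : ℝ) : ℝ :=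
  sSup ((fun x : Plane => inner ℝ x (dirN φ)) '' K)

/-- The curve with generalized support function `f`: the envelope of the lines
`x cos θ + y sin θ = f(θ)`, parametrized by the angle `θ` of the normal. -/
def envelope (f : ℝ → ℝ) (θ : ℝ) : Plane := f θ • dirN θ + deriv f θ • dirT θ

/-- A compact convex set, strictly convex in the `C²` sense: the support function `p` is `C²`
and the radius of curvature `p + p''` of the boundary is everywhere positive. -/
structure IsStrictlyConvexC2 (K : Set Plane) : Prop where
  nonempty : K.Nonempty
  isCompact : IsCompact K
  convex : Convex ℝ K
  contDiff : ContDiff ℝ 2 (supportFun K)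
  radius_pos : ∀ φ, 0 < supportFun K φ + deriv (deriv (supportFun K)) φ

/-- Constant width: the orthogonal projections of `K` on all directions have the same length. -/
def HasConstantWidth (K : Set Plane) : Prop :=
  ∃ w : ℝ, ∀ φ : ℝ, volume.real ((fun x : Plane => inner ℝ x (dirN φ)) '' K) = w

/-- The length `L` of the boundary of `K`, which is parametrized by its normal angle as the
envelope of the support lines of `K`. -/
def boundaryLength (K : Set Plane) : ℝ :=
  ∫ φ in (0 : ℝ)..(2 * Real.pi), ‖deriv (envelope (supportFun K)) φ‖

/-- The isoperimetric deficit `Δ = L² - 4πF`, with `F` the area of `K`. -/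
def isoDeficit (K : Set Plane) : ℝ :=
  boundaryLength K ^ 2 - 4 * Real.pi * volume.real K

/-- The area with multiplicities (swept by the radius vector over one period) of the closed curve
with `2π`-periodic generalized support function `f`; see `signedArea_eq`. In this form it makes
sense for every `f` of class `C¹`. -/
def signedArea (f : ℝ → ℝ) : ℝ :=
  1 / 2 * ∫ θ in (0 : ℝ)..(2 * Real.pi), (f θ ^ 2 - deriv f θ ^ 2)

/-- The generalized support function of the evolute of the curve with support function `p`.
The evolute is the envelope of the normals `⟨x, N'(φ)⟩ = p'(φ)`, and `N'(φ) = N(φ + π/2)`;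
see `envelope_evoluteSupport`. -/
def evoluteSupport (p : ℝ → ℝ) (θ : ℝ) : ℝ := deriv p (θ - Real.pi / 2)

/-- The area with multiplicities `F_e` of the evolute of the boundary of `K`. -/
def evoluteArea (K : Set Plane) : ℝ := signedArea (evoluteSupport (supportFun K))

/-- The points at which a line through `P` touches `K`: the points of `K` lying on a
support line of `K` through `P`. -/
def tangencyPoints (K : Set Plane) (P : Plane) : Set Plane :=
  {x | x ∈ K ∧ ∃ u : Plane, u ≠ 0 ∧ inner ℝ u (x - P) = (0 : ℝ) ∧
    ∀ y ∈ K, inner ℝ u (y - P) ≤ (0 : ℝ)}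

/-- The visual angle `ω` of the boundary of `K` from `P`: the angle at `P` between the two tangents
from `P` (the supremum only selects the two distinct tangency points). -/
def visualAngle (K : Set Plane) (P : Plane) : ℝ :=
  sSup {a | ∃ x ∈ tangencyPoints K P, ∃ y ∈ tangencyPoints K P,
    a = EuclideanGeometry.angle x P y}

/-- The function `ω - 2 sin ω + sin 2ω - ¼ sin 4ω - sin³ ω`. -/
def angleIntegrand (ω : ℝ) : ℝ :=
  ω - 2 * Real.sin ω + Real.sin (2 * ω) - 1 / 4 * Real.sin (4 * ω) - Real.sin ω ^ 3

/-- The hypocycloid traced by a point of a circle of radius `r` rolling inside a circle of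
radius `k * r`. -/
def hypocycloid (r k t : ℝ) : Plane :=
  !₂[r * (k - 1) * Real.sin t - r * Real.sin ((k - 1) * t),
     r * (k - 1) * Real.cos t + r * Real.cos ((k - 1) * t)]

/-- Rotation of the plane by the angle `α`. -/
def rotate (α : ℝ) (v : Plane) : Plane :=
  !₂[Real.cos α * v 0 - Real.sin α * v 1, Real.sin α * v 0 + Real.cos α * v 1]

/-- `f` is a generalized support function (over one period `2π`) of a hypocycloid with `m` cusps,
that is, with ratio of radii `k = m / n > 2` in lowest terms, in arbitrary position and size.
While the parameter `t` of the hypocycloid runs, its normal turns at the rate `(k - 2) / 2`. -/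
def IsHypocycloidSupport (m : ℕ) (f : ℝ → ℝ) : Prop :=
  ContDiff ℝ 2 f ∧ Function.Periodic f (2 * Real.pi) ∧
    ∃ n : ℕ, 0 < n ∧ Nat.Coprime m n ∧ 2 * n < m ∧
      ∃ (r α : ℝ) (c : Plane), 0 < r ∧ ∀ t : ℝ,
        envelope f (α + ((m / n : ℝ) - 2) / 2 * t) = c + rotate α (hypocycloid r (m / n) t)

/-- `f` is a generalized support function of a curve parallel (at a signed distance `d`) to a
hypocycloid with `m` cusps. -/
def IsParallelToHypocycloid (m : ℕ) (f : ℝ → ℝ) : Prop :=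
  ∃ g : ℝ → ℝ, IsHypocycloidSupport m g ∧ ∃ d : ℝ, ∀ φ, f φ = g φ + d

/-- The sets `D` occurring as summands, given by their generalized support functions: disks, and
domains bounded by a curve parallel to a Steiner curve (three cusps) or to a hypocycloid with five
cusps. They need not be convex. -/
def IsSummand (f : ℝ → ℝ) : Prop :=
  (∃ (c : Plane) (R : ℝ), 0 < R ∧ f = supportFun (Metric.closedBall c R)) ∨
    IsParallelToHypocycloid 3 f ∨ IsParallelToHypocycloid 5 f

/-- `K` is the Minkowski sum of finitely many summands as above: since these need not be convex,
the Minkowski sum is the one given by addition of the generalized support functions. -/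
def IsMinkowskiSum (K : Set Plane) : Prop :=
  ∃ (n : ℕ) (f : Fin (n + 1) → ℝ → ℝ), (∀ i, IsSummand (f i)) ∧
    ∀ φ, supportFun K φ = ∑ i, f i φ

/-- The left-hand side `(4/9) π |F_e| - Δ`. -/
def widthDeficit (K : Set Plane) : ℝ :=
  4 / 9 * Real.pi * |evoluteArea K| - isoDeficit K

/-- The right-hand side `(64/9) ∫_{P ∉ K} (ω - 2 sin ω + sin 2ω - ¼ sin 4ω - sin³ ω) dP`. -/
def visualBound (K : Set Plane) : ℝ :=
  64 / 9 * ∫ P in Kᶜ, angleIntegrand (visualAngle K P)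

theorem hasDerivAt_of_coord {f : ℝ → Plane} {v : Plane} {θ : ℝ}
    (h : ∀ i, HasDerivAt (fun s => f s i) (v i) θ) : HasDerivAt f v θ := by
  have h1 : HasDerivAt (fun s => (f s).ofLp) v.ofLp θ := hasDerivAt_pi.2 h
  exact (PiLp.continuousLinearEquiv 2 ℝ (fun _ : Fin 2 => ℝ)).symm.hasFDerivAt.comp_hasDerivAt θ h1

theorem hasDerivAt_dirN (θ : ℝ) : HasDerivAt dirN (dirT θ) θ := by
  refine hasDerivAt_of_coord fun i => ?_
  fin_cases i
  · simpa [dirN, dirT] using Real.hasDerivAt_cos θ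
  · simpa [dirN, dirT] using Real.hasDerivAt_sin θ

theorem hasDerivAt_dirT (θ : ℝ) : HasDerivAt dirT (-dirN θ) θ := by
  refine hasDerivAt_of_coord fun i => ?_
  fin_cases i
  · simpa [dirN, dirT] using (Real.hasDerivAt_sin θ).fun_neg
  · simpa [dirN, dirT] using Real.hasDerivAt_cos θ

/-- The evolute consists of the centers of curvature. -/
theorem envelope_evoluteSupport (p : ℝ → ℝ) (φ : ℝ) :
    envelope (evoluteSupport p) (φ + Real.pi / 2) =
      envelope p φ - (p φ + deriv (deriv p) φ) • dirN φ := by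
  have h1 : deriv (evoluteSupport p) (φ + Real.pi / 2) = deriv (deriv p) φ := by
    have := deriv_comp_sub_const (f := deriv p) (a := Real.pi / 2) (x := φ + Real.pi / 2)
    rw [add_sub_cancel_right] at this
    exact this
  ext i
  fin_cases i <;>
    simp [envelope, h1, evoluteSupport, dirN, dirT, Real.cos_add_pi_div_two,
      Real.sin_add_pi_div_two] <;> ring

theorem hasDerivAt_envelope {f : ℝ → ℝ} (hf : ContDiff ℝ 2 f) (θ : ℝ) :
    HasDerivAt (envelope f) ((f θ + deriv (deriv f) θ) • dirT θ) θ := by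
  have h0 : HasDerivAt f (deriv f θ) θ := (hf.differentiable (by norm_num) θ).hasDerivAt
  have h1 : HasDerivAt (deriv f) (deriv (deriv f) θ) θ :=
    ((hf.iterate_deriv' 1 1).differentiable (by norm_num) θ).hasDerivAt
  have := (h0.smul (hasDerivAt_dirN θ)).add (h1.smul (hasDerivAt_dirT θ))
  refine this.congr_deriv ?_
  module

/-- For `f` of class `C²`, `signedArea f` is `½ ∮ (x dy - y dx)` along the envelope. -/
theorem signedArea_eq {f : ℝ → ℝ} (hf : ContDiff ℝ 2 f)
    (hper : Function.Periodic f (2 * Real.pi)) :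
    signedArea f = 1 / 2 * ∫ θ in (0 : ℝ)..(2 * Real.pi),
      (envelope f θ 0 * deriv (envelope f) θ 1 - envelope f θ 1 * deriv (envelope f) θ 0) := by
  have hd : ContDiff ℝ 1 (deriv f) := hf.iterate_deriv' 1 1
  have h0 : ∀ θ, HasDerivAt f (deriv f θ) θ :=
    fun θ => (hf.differentiable (by norm_num) θ).hasDerivAt
  have h1 : ∀ θ, HasDerivAt (deriv f) (deriv (deriv f) θ) θ :=
    fun θ => (hd.differentiable (by norm_num) θ).hasDerivAt
  have c0 : Continuous f := hf.continuous
  have c1 : Continuous (deriv f) := hd.continuous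
  have c2 : Continuous (deriv (deriv f)) := hd.continuous_deriv le_rfl
  have hper' : deriv f (2 * Real.pi) = deriv f 0 := by
    have h := deriv_comp_add_const (f := f) (a := 2 * Real.pi) (x := 0)
    have e : (fun x => f (x + 2 * Real.pi)) = f := funext hper
    rw [e] at h
    simpa using h.symm
  have hf0 : f (2 * Real.pi) = f 0 := by simpa using hper 0
  have key := intervalIntegral.integral_eq_sub_of_hasDerivAt (a := 0) (b := 2 * Real.pi)
    (f := fun θ => f θ * deriv f θ)
    (f' := fun θ => deriv f θ * deriv f θ + f θ * deriv (deriv f) θ)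
    (fun θ _ => (h0 θ).mul (h1 θ)) ((by fun_prop : Continuous _).intervalIntegrable _ _)
  rw [hper', hf0, sub_self] at key
  have e : ∀ θ, envelope f θ 0 * deriv (envelope f) θ 1 - envelope f θ 1 * deriv (envelope f) θ 0
      = (f θ ^ 2 - deriv f θ ^ 2) + (deriv f θ * deriv f θ + f θ * deriv (deriv f) θ) := by
    intro θ
    rw [(hasDerivAt_envelope hf θ).deriv]
    simp only [envelope, dirN, dirT, PiLp.add_apply, PiLp.smul_apply, smul_eq_mul]
    simp
    linear_combination (f θ * (f θ + deriv (deriv f) θ)) * Real.sin_sq_add_cos_sq θ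
  simp_rw [e]
  rw [intervalIntegral.integral_add ((by fun_prop : Continuous _).intervalIntegrable _ _)
    ((by fun_prop : Continuous _).intervalIntegrable _ _), key, add_zero]
  rfl

end HurwitzWidth

end

noncomputable section

namespace HurwitzWidth

open MeasureTheory Set Filter Topology

/-! ### Functions with positive radius of curvature -/

/-! Both sides are quadratic in the support function `p`. In terms of its Fourier coefficients `c_n`
both become diagonal, and the theorem is a comparison of the two series term by term.

For the left side, Parseval gives `Δ = 4π² Σ_{n≠0} (n²-1)|c_n|²` and `|F_e| = π Σ n²(n²-1)|c_n|²`.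
Constant width makes `p(φ) + p(φ+π)` constant and kills the even harmonics except `n = 0`. Hence
`(4/9)π|F_e| - Δ = (4π²/9) Σ (n²-1)(n²-9)|c_n|²`, where only odd `|n| ≥ 5` contribute
(`hasSum_widthDeficit`).

For the right side, an exterior point `P` is given by the normal angles `φ` and `φ+τ` of its two
tangents, so that `ω = π - τ`. The tangent at `φ` has length `t = supportGap/sin τ`, and the area
element is `t ∂_τ t dφ dτ`, half the `τ`-derivative of `t²`. Integration by parts moves the
derivative onto the function `g` of `ω` and leaves `½ ∬ supportGap² · g'(π-τ)/sin² τ`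
(`angle_integral`). In the Fourier basis `supportGap` is multiplication by `e^{inτ} - cos τ - i n
sin τ`. Integrating the squared modulus of this multiplier against the kernel `2/(1-cos τ) + 3 cos τ
+ 4 cos 2τ` gives `π(n²-1)` for odd `|n| ≥ 5`, and `0` for `n = 0, ±1, ±3`
(`integral_angleKernel_mul_gapMultiplier`). So the right side is `(4π²/9) Σ 16(n²-1)|c_n|²` over odd
`|n| ≥ 5`.

The difference of the two sides has terms `(n²-1)(n²-25)|c_n|² ≥ 0`. Each side vanishes exactly when
`c_n = 0` for all `|n| ≥ 5`. Equality holds exactly when only the frequencies `0, 1, 3, 5` occur.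
The frequencies `0` and `1` give a disk and its position, and `3` and `5` are the support functions
of the hypocycloids with three and five cusps. -/

theorem hasDerivAt_of_contDiff {f : ℝ → ℝ} (hf : ContDiff ℝ 2 f) (x : ℝ) :
    HasDerivAt f (deriv f x) x :=
  (hf.differentiable (by norm_num) x).hasDerivAt

theorem hasDerivAt_deriv_of_contDiff {f : ℝ → ℝ} (hf : ContDiff ℝ 2 f) (x : ℝ) :
    HasDerivAt (deriv f) (deriv (deriv f) x) x :=
  ((hf.iterate_deriv' 1 1).differentiable (by norm_num) x).hasDerivAt

theorem continuous_deriv_of_contDiff {f : ℝ → ℝ} (hf : ContDiff ℝ 2 f) :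
    Continuous (deriv f) :=
  (hf.iterate_deriv' 1 1).continuous

theorem continuous_deriv_deriv_of_contDiff {f : ℝ → ℝ} (hf : ContDiff ℝ 2 f) :
    Continuous (deriv (deriv f)) :=
  ContDiff.continuous_deriv (n := 1) (hf.iterate_deriv' 1 1) le_rfl

theorem periodic_deriv {f : ℝ → ℝ} {c : ℝ} (h : Function.Periodic f c) :
    Function.Periodic (deriv f) c := by
  intro x
  rw [← deriv_comp_add_const]
  congr 1
  exact funext h

/-- The distance from the support line with normal angle `φ + τ` of the point of the envelope with
normal angle `φ`. -/
def supportGap (f : ℝ → ℝ) (φ τ : ℝ) : ℝ :=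
  f (φ + τ) - f φ * Real.cos τ - deriv f φ * Real.sin τ

/-- The gap is the integral over `[0, τ]` of the radius of curvature at `φ + s` against `sin(τ -
s)`, which is positive as long as `τ ≤ π`. -/
theorem supportGap_pos_of_pos {f : ℝ → ℝ} (hf : ContDiff ℝ 2 f)
    (hpos : ∀ x, 0 < f x + deriv (deriv f) x) (φ : ℝ) {τ : ℝ} (h0 : 0 < τ) (h1 : τ ≤ Real.pi) :
    0 < supportGap f φ τ := by
  -- Here `W τ - W 0` is the gap, and in the derivative of `W` only the combination `f + f''`
  -- survives.
  set W : ℝ → ℝ := fun s => deriv f (φ + s) * Real.sin (τ - s) + f (φ + s) * Real.cos (τ - s)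
  have hW : ∀ s, HasDerivAt W ((f (φ + s) + deriv (deriv f) (φ + s)) * Real.sin (τ - s)) s := by
    intro s
    have e1 : HasDerivAt (fun s => f (φ + s)) (deriv f (φ + s)) s := by
      simpa using (hasDerivAt_of_contDiff hf (φ + s)).comp_const_add φ s
    have e2 : HasDerivAt (fun s => deriv f (φ + s)) (deriv (deriv f) (φ + s)) s := by
      simpa using (hasDerivAt_deriv_of_contDiff hf (φ + s)).comp_const_add φ s
    have e3 : HasDerivAt (fun s => τ - s) (-1) s := by
      simpa using (hasDerivAt_id s).const_sub τ
    refine ((e2.mul e3.sin).add (e1.mul e3.cos)).congr_deriv ?_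
    ring
  have hmono : StrictMonoOn W (Icc 0 τ) := by
    apply strictMonoOn_of_deriv_pos (convex_Icc _ _)
      (fun s _ => (hW s).continuousAt.continuousWithinAt)
    intro s hs
    rw [interior_Icc] at hs
    rw [(hW s).deriv]
    exact mul_pos (hpos _) (Real.sin_pos_of_pos_of_lt_pi (by linarith [hs.2]) (by linarith [hs.1]))
  have := hmono (left_mem_Icc.2 h0.le) (right_mem_Icc.2 h0.le) h0
  simp only [W, add_zero, sub_zero, sub_self, Real.sin_zero, Real.cos_zero] at this
  unfold supportGap
  linarith

theorem deriv_comp_neg' (f : ℝ → ℝ) : deriv (fun x => f (-x)) = fun x => -deriv f (-x) :=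
  funext fun x => deriv_comp_neg f x

theorem supportGap_pos_of_neg {f : ℝ → ℝ} (hf : ContDiff ℝ 2 f)
    (hpos : ∀ x, 0 < f x + deriv (deriv f) x) (φ : ℝ) {τ : ℝ} (h0 : τ < 0) (h1 : -Real.pi ≤ τ) :
    0 < supportGap f φ τ := by
  have hg : ContDiff ℝ 2 (fun x => f (-x)) := hf.comp contDiff_neg
  have h2 : deriv (deriv fun x => f (-x)) = fun x => deriv (deriv f) (-x) := by
    rw [deriv_comp_neg']
    funext x
    rw [deriv.fun_neg, deriv_comp_neg, neg_neg]
  have := supportGap_pos_of_pos hg (fun x => by rw [h2]; exact hpos (-x)) (-φ) (τ := -τ)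
    (by linarith) (by linarith)
  simp only [supportGap, deriv_comp_neg', neg_neg, Real.cos_neg, Real.sin_neg, neg_add] at this
  unfold supportGap
  linarith

theorem continuous_supportGap {f : ℝ → ℝ} (hf : ContDiff ℝ 2 f) :
    Continuous fun x : ℝ × ℝ => supportGap f x.1 x.2 := by
  have := hf.continuous
  have := continuous_deriv_of_contDiff hf
  unfold supportGap
  fun_prop

/-- Comparison with a disk of radius `M`, whose gap is `M (1 - cos τ)`: positivity of the gap is
applied to `M - f`. -/
theorem supportGap_lt_of_bound {f : ℝ → ℝ} (hf : ContDiff ℝ 2 f) {M : ℝ}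
    (hM : ∀ x, f x + deriv (deriv f) x < M) (φ : ℝ) {τ : ℝ} (h0 : τ ≠ 0) (h1 : |τ| ≤ Real.pi) :
    supportGap f φ τ < M * (1 - Real.cos τ) := by
  have hg : ContDiff ℝ 2 (fun x => M - f x) := contDiff_const.sub hf
  have hd : deriv (fun x => M - f x) = fun x => -deriv f x := funext fun x => by
    simp
  have h2 : deriv (deriv fun x => M - f x) = fun x => -deriv (deriv f) x := by
    rw [hd]
    funext x
    simp
  have key : 0 < supportGap (fun x => M - f x) φ τ := by
    rcases lt_or_gt_of_ne h0 with h | h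
    · exact supportGap_pos_of_neg hg (fun x => by rw [h2]; linarith [hM x]) φ h
        (by linarith [neg_abs_le τ])
    · exact supportGap_pos_of_pos hg (fun x => by rw [h2]; linarith [hM x]) φ h
        (by linarith [le_abs_self τ])
  simp only [supportGap, hd] at key
  unfold supportGap
  linarith

/-! ### Coordinates -/

theorem inner_plane (x y : Plane) : inner ℝ x y = x 0 * y 0 + x 1 * y 1 := by
  simp [PiLp.inner_apply, Fin.sum_univ_two, mul_comm]

theorem inner_dirN (x : Plane) (φ : ℝ) :
    inner ℝ x (dirN φ) = x 0 * Real.cos φ + x 1 * Real.sin φ := by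
  simp [inner_plane, dirN]

theorem inner_dirT (x : Plane) (φ : ℝ) :
    inner ℝ x (dirT φ) = -(x 0 * Real.sin φ) + x 1 * Real.cos φ := by
  simp [inner_plane, dirT]

@[simp] theorem dirN_zero (φ : ℝ) : dirN φ 0 = Real.cos φ := by simp [dirN]
@[simp] theorem dirN_one (φ : ℝ) : dirN φ 1 = Real.sin φ := by simp [dirN]
@[simp] theorem dirT_zero (φ : ℝ) : dirT φ 0 = -Real.sin φ := by simp [dirT]
@[simp] theorem dirT_one (φ : ℝ) : dirT φ 1 = Real.cos φ := by simp [dirT]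

theorem dirN_periodic : Function.Periodic dirN (2 * Real.pi) := fun φ => by simp [dirN]
theorem dirT_periodic : Function.Periodic dirT (2 * Real.pi) := fun φ => by simp [dirT]

theorem plane_ext {x y : Plane} (h0 : x 0 = y 0) (h1 : x 1 = y 1) : x = y := by
  ext i
  fin_cases i
  · exact h0
  · exact h1

/-- A point is determined by its coordinates in the frame `dirN φ`, `dirT φ`. -/
theorem eq_of_inner_eq {x y : Plane} (φ : ℝ) (hN : inner ℝ x (dirN φ) = inner ℝ y (dirN φ))
    (hT : inner ℝ x (dirT φ) = inner ℝ y (dirT φ)) : x = y := by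
  rw [inner_dirN, inner_dirN] at hN
  rw [inner_dirT, inner_dirT] at hT
  have := Real.sin_sq_add_cos_sq φ
  refine plane_ext ?_ ?_
  · linear_combination Real.cos φ * hN - Real.sin φ * hT - (x 0 - y 0) * this
  · linear_combination Real.sin φ * hN + Real.cos φ * hT - (x 1 - y 1) * this

theorem inner_dirN_add (x : Plane) (φ τ : ℝ) : inner ℝ x (dirN (φ + τ)) =
    inner ℝ x (dirN φ) * Real.cos τ + inner ℝ x (dirT φ) * Real.sin τ := by
  simp only [inner_dirN, inner_dirT, Real.cos_add, Real.sin_add]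
  ring

theorem exists_eq_norm_smul_dirN (u : Plane) : ∃ θ, u = ‖u‖ • dirN θ := by
  refine ⟨Complex.arg ⟨u 0, u 1⟩, ?_⟩
  have hn : ‖u‖ = ‖(⟨u 0, u 1⟩ : ℂ)‖ := by
    rw [EuclideanSpace.norm_eq, Complex.norm_eq_sqrt_sq_add_sq, Fin.sum_univ_two]
    simp
  rw [hn]
  refine plane_ext ?_ ?_
  · simp [Complex.norm_mul_cos_arg]
  · simp [Complex.norm_mul_sin_arg]

theorem norm_dirN (φ : ℝ) : ‖dirN φ‖ = 1 := by
  rw [EuclideanSpace.norm_eq, Fin.sum_univ_two]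
  simp

theorem norm_dirT (φ : ℝ) : ‖dirT φ‖ = 1 := by
  rw [EuclideanSpace.norm_eq, Fin.sum_univ_two]
  simp

theorem inner_envelope_dirN (f : ℝ → ℝ) (φ : ℝ) : inner ℝ (envelope f φ) (dirN φ) = f φ := by
  simp only [inner_dirN, envelope, PiLp.add_apply, PiLp.smul_apply, smul_eq_mul, dirN_zero,
    dirN_one, dirT_zero, dirT_one]
  linear_combination f φ * Real.sin_sq_add_cos_sq φ

theorem inner_envelope_dirT (f : ℝ → ℝ) (φ : ℝ) :
    inner ℝ (envelope f φ) (dirT φ) = deriv f φ := by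
  simp only [inner_dirT, envelope, PiLp.add_apply, PiLp.smul_apply, smul_eq_mul, dirN_zero,
    dirN_one, dirT_zero, dirT_one]
  linear_combination deriv f φ * Real.sin_sq_add_cos_sq φ

theorem inner_dirT_dirN (φ : ℝ) : inner ℝ (dirT φ) (dirN φ) = 0 := by
  simp [inner_dirN]; ring

theorem inner_dirT_self (φ : ℝ) : inner ℝ (dirT φ) (dirT φ) = 1 := by
  rw [real_inner_self_eq_norm_sq, norm_dirT, one_pow]

/-! ### The support function of a compact convex set -/

theorem inner_le_supportFun {K : Set Plane} (hK : IsCompact K) {x : Plane} (hx : x ∈ K) (φ : ℝ) :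
    inner ℝ x (dirN φ) ≤ supportFun K φ :=
  le_csSup (hK.image (by fun_prop : Continuous fun x : Plane => inner ℝ x (dirN φ))).bddAbove
    (mem_image_of_mem _ hx)

theorem exists_inner_eq_supportFun {K : Set Plane} (hK : IsCompact K) (hne : K.Nonempty) (φ : ℝ) :
    ∃ x ∈ K, inner ℝ x (dirN φ) = supportFun K φ :=
  (hK.image (by fun_prop : Continuous fun x : Plane => inner ℝ x (dirN φ))).sSup_mem
    (hne.image _)

theorem supportFun_periodic (K : Set Plane) : Function.Periodic (supportFun K) (2 * Real.pi) := by
  intro φ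
  simp only [supportFun, dirN_periodic φ]

theorem supportFun_closedBall (c : Plane) {R : ℝ} (hR : 0 ≤ R) (φ : ℝ) :
    supportFun (Metric.closedBall c R) φ = inner ℝ c (dirN φ) + R := by
  apply le_antisymm
  · refine csSup_le ((Metric.nonempty_closedBall.2 hR).image _) ?_
    rintro _ ⟨x, hx, rfl⟩
    have h1 : inner ℝ (x - c) (dirN φ) ≤ ‖x - c‖ * ‖dirN φ‖ := real_inner_le_norm _ _
    rw [norm_dirN, mul_one, inner_sub_left] at h1
    rw [mem_closedBall_iff_norm] at hx
    simp only
    linarith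
  · have := inner_le_supportFun (isCompact_closedBall c R) (x := c + R • dirN φ)
      (by simp [norm_smul, norm_dirN, abs_of_nonneg hR]) φ
    rwa [inner_add_left, real_inner_smul_left, real_inner_self_eq_norm_sq, norm_dirN, one_pow,
      mul_one] at this

/-- A point of `K` on the support line with normal angle `φ` is the point of the envelope. -/
theorem eq_envelope_of_inner_eq {K : Set Plane} (hK : IsCompact K)
    (hp : ContDiff ℝ 2 (supportFun K)) {x : Plane} (hx : x ∈ K) {φ : ℝ}
    (h : inner ℝ x (dirN φ) = supportFun K φ) : x = envelope (supportFun K) φ := by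
  refine eq_of_inner_eq φ (by rw [h, inner_envelope_dirN]) ?_
  rw [inner_envelope_dirT]
  have hd : HasDerivAt (fun θ => supportFun K θ - inner ℝ x (dirN θ))
      (deriv (supportFun K) φ - inner ℝ x (dirT φ)) φ := by
    refine (hasDerivAt_of_contDiff hp φ).sub ?_
    simpa using (hasDerivAt_const φ x).inner ℝ (hasDerivAt_dirN φ)
  -- The nonnegative function `θ ↦ p(θ) - ⟨x, N(θ)⟩` vanishes at `φ`, so its derivative vanishes
  -- there too, which fixes the tangential coordinate of `x`.
  have hmin : IsLocalMin (fun θ => supportFun K θ - inner ℝ x (dirN θ)) φ :=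
    Filter.Eventually.of_forall fun θ => by
      simp only [h, sub_self]
      linarith [inner_le_supportFun hK hx θ]
  have := hmin.hasDerivAt_eq_zero hd
  linarith

theorem envelope_mem {K : Set Plane} (hK : IsStrictlyConvexC2 K) (φ : ℝ) :
    envelope (supportFun K) φ ∈ K := by
  obtain ⟨x, hx, h⟩ := exists_inner_eq_supportFun hK.isCompact hK.nonempty φ
  rwa [← eq_envelope_of_inner_eq hK.isCompact hK.contDiff hx h]

theorem mem_iff_forall_inner_le {K : Set Plane} (hne : K.Nonempty) (hK : IsCompact K)
    (hc : Convex ℝ K) {x : Plane} :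
    x ∈ K ↔ ∀ φ, inner ℝ x (dirN φ) ≤ supportFun K φ := by
  refine ⟨fun hx φ => inner_le_supportFun hK hx φ, fun h => ?_⟩
  by_contra hx
  obtain ⟨f, u, hu, hux⟩ := geometric_hahn_banach_closed_point hc hK.isClosed hx
  set v := (InnerProductSpace.toDual ℝ Plane).symm f with hv
  have hf : ∀ y, f y = inner ℝ v y := fun y => by simp [hv]
  obtain ⟨θ, hθ⟩ := exists_eq_norm_smul_dirN v
  obtain ⟨y, hy, hyp⟩ := exists_inner_eq_supportFun hK hne θ
  have h1 : f y < f x := (hu y hy).trans hux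
  rw [hf, hf, hθ, real_inner_smul_left, real_inner_smul_left, real_inner_comm, hyp,
    real_inner_comm x] at h1
  exact absurd (mul_le_mul_of_nonneg_left (h θ) (norm_nonneg v)) (not_le.2 h1)

theorem eq_of_supportFun_eq {K K' : Set Plane} (hne : K.Nonempty) (hK : IsCompact K)
    (hc : Convex ℝ K) (hne' : K'.Nonempty) (hK' : IsCompact K') (hc' : Convex ℝ K')
    (h : ∀ φ, supportFun K φ = supportFun K' φ) : K = K' := by
  ext x
  rw [mem_iff_forall_inner_le hne hK hc, mem_iff_forall_inner_le hne' hK' hc']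
  simp_rw [h]

/-- The projection on `N(φ)` is the interval from `-p(φ+π)` to `p(φ)`. Constant width is used later
only in this form. -/
theorem supportFun_add_eq_of_constantWidth {K : Set Plane} (hne : K.Nonempty) (hK : IsCompact K)
    (hc : Convex ℝ K) (hw : HasConstantWidth K) :
    ∃ w : ℝ, ∀ φ, supportFun K φ + supportFun K (φ + Real.pi) = w := by
  obtain ⟨w, hw⟩ := hw
  refine ⟨w, fun φ => ?_⟩
  rw [← hw φ]
  have hcont : Continuous fun x : Plane => inner ℝ x (dirN φ) := by fun_prop
  set S := (fun x : Plane => inner ℝ x (dirN φ)) '' K with hS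
  have hScomp : IsCompact S := hK.image hcont
  have hSc : IsConnected S := ⟨hne.image _, hc.isPreconnected.image _ hcont.continuousOn⟩
  have hI : S = Icc (sInf S) (sSup S) := eq_Icc_of_connected_compact hSc hScomp
  have hneg : dirN (φ + Real.pi) = -dirN φ := plane_ext (by simp) (by simp)
  have h2 : supportFun K (φ + Real.pi) = -sInf S := by
    rw [supportFun, hneg, Real.sInf_def, neg_neg, hS, ← Set.image_neg_eq_neg, Set.image_image]
    simp only [inner_neg_right]
  rw [h2, hI, Real.volume_real_Icc_of_le, ← hI]
  · change sSup S + _ = _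
    ring
  · exact csInf_le_csSup (hne.image _) hScomp.bddBelow hScomp.bddAbove

/-! ### Coordinates on the exterior of a convex set -/

/-- The point at signed distance `t` from the point of tangency on the oriented tangent with normal
angle `φ` of the curve with support function `f`. -/
def tangentPoint (f : ℝ → ℝ) (φ t : ℝ) : Plane := envelope f φ + t • dirT φ

theorem inner_tangentPoint_dirN (f : ℝ → ℝ) (φ t : ℝ) :
    inner ℝ (tangentPoint f φ t) (dirN φ) = f φ := by
  rw [tangentPoint, inner_add_left, inner_envelope_dirN, real_inner_smul_left, inner_dirT_dirN,
    mul_zero, add_zero]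

theorem inner_tangentPoint_dirT (f : ℝ → ℝ) (φ t : ℝ) :
    inner ℝ (tangentPoint f φ t) (dirT φ) = deriv f φ + t := by
  rw [tangentPoint, inner_add_left, inner_envelope_dirT, real_inner_smul_left, inner_dirT_self,
    mul_one]

theorem sub_inner_tangentPoint (f : ℝ → ℝ) (φ t τ : ℝ) :
    f (φ + τ) - inner ℝ (tangentPoint f φ t) (dirN (φ + τ)) =
      supportGap f φ τ - t * Real.sin τ := by
  rw [inner_dirN_add, inner_tangentPoint_dirN, inner_tangentPoint_dirT, supportGap]
  ring

theorem eq_tangentPoint {f : ℝ → ℝ} {P : Plane} {φ : ℝ} (h : inner ℝ P (dirN φ) = f φ) :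
    P = tangentPoint f φ (inner ℝ P (dirT φ) - deriv f φ) := by
  refine eq_of_inner_eq φ ?_ ?_
  · rw [inner_tangentPoint_dirN, h]
  · rw [inner_tangentPoint_dirT]
    ring

theorem envelope_periodic {f : ℝ → ℝ} (hper : Function.Periodic f (2 * Real.pi)) :
    Function.Periodic (envelope f) (2 * Real.pi) := by
  intro φ
  simp only [envelope, hper φ, periodic_deriv hper φ, dirN_periodic φ, dirT_periodic φ]

theorem tangentPoint_periodic {f : ℝ → ℝ} (hper : Function.Periodic f (2 * Real.pi)) (t : ℝ) :
    Function.Periodic (fun φ => tangentPoint f φ t) (2 * Real.pi) := by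
  intro φ
  simp only [tangentPoint, envelope_periodic hper φ, dirT_periodic φ]

/-- The gap is `2π`-periodic in `τ`, so positivity for `0 < |τ| ≤ π` extends to `0 < |τ| < 2π`. -/
theorem supportGap_pos {f : ℝ → ℝ} (hf : ContDiff ℝ 2 f)
    (hper : Function.Periodic f (2 * Real.pi))
    (hpos : ∀ x, 0 < f x + deriv (deriv f) x) (φ : ℝ) {τ : ℝ} (h0 : τ ≠ 0)
    (h1 : |τ| < 2 * Real.pi) : 0 < supportGap f φ τ := by
  have hgap : ∀ τ, supportGap f φ (τ + 2 * Real.pi) = supportGap f φ τ := fun τ => by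
    rw [supportGap, supportGap, ← add_assoc, hper, Real.cos_add_two_pi, Real.sin_add_two_pi]
  rw [abs_lt] at h1
  rcases lt_or_gt_of_ne h0 with h | h
  · rcases le_or_gt (-Real.pi) τ with h2 | h2
    · exact supportGap_pos_of_neg hf hpos φ h h2
    · rw [← hgap]
      exact supportGap_pos_of_pos hf hpos φ (by linarith) (by linarith)
  · rcases le_or_gt τ Real.pi with h2 | h2
    · exact supportGap_pos_of_pos hf hpos φ h h2
    · rw [← sub_add_cancel τ (2 * Real.pi), hgap]
      exact supportGap_pos_of_neg hf hpos φ (by linarith) (by linarith)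

/-- If a point lay at positive distances `t`, `s` on the oriented tangents at `φ ≠ ψ`, then `t
sin(ψ-φ)` and `s sin(φ-ψ)` would both be gaps, hence both positive, although the sines have opposite
signs. -/
theorem tangentPoint_injOn {f : ℝ → ℝ} (hf : ContDiff ℝ 2 f)
    (hper : Function.Periodic f (2 * Real.pi)) (hpos : ∀ x, 0 < f x + deriv (deriv f) x) :
    InjOn (fun x : ℝ × ℝ => tangentPoint f x.1 x.2) (Ico 0 (2 * Real.pi) ×ˢ Ioi 0) := by
  rintro ⟨φ, t⟩ ⟨hφ, ht⟩ ⟨ψ, s⟩ ⟨hψ, hs⟩ h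
  simp only [mem_Ico, mem_Ioi] at hφ ht hψ hs h
  have hφψ : φ = ψ := by
    by_contra hne
    have hd : |ψ - φ| < 2 * Real.pi := by rw [abs_lt]; constructor <;> linarith
    have g1 := supportGap_pos hf hper hpos φ (sub_ne_zero.2 (Ne.symm hne)) hd
    have g2 := supportGap_pos hf hper hpos ψ (τ := φ - ψ) (sub_ne_zero.2 hne)
      (by rwa [abs_sub_comm])
    have e1 := sub_inner_tangentPoint f φ t (ψ - φ)
    have e2 := sub_inner_tangentPoint f ψ s (φ - ψ)
    rw [add_sub_cancel, h, inner_tangentPoint_dirN] at e1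
    rw [add_sub_cancel, ← h, inner_tangentPoint_dirN, ← neg_sub ψ φ, Real.sin_neg] at e2
    rw [← neg_sub ψ φ] at g2
    have h1 : 0 < t * Real.sin (ψ - φ) := by linarith
    have h2 : 0 < s * -Real.sin (ψ - φ) := by linarith
    have h3 := pos_of_mul_pos_right h1 ht.le
    have h4 := pos_of_mul_pos_right h2 hs.le
    linarith
  subst hφψ
  have := inner_tangentPoint_dirT f φ t
  rw [h, inner_tangentPoint_dirT] at this
  simp only [Prod.mk.injEq, true_and]
  linarith

theorem tangentPoint_notMem {K : Set Plane} (hK : IsStrictlyConvexC2 K) (φ : ℝ) {t : ℝ}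
    (ht : 0 < t) : tangentPoint (supportFun K) φ t ∉ K := by
  intro h
  have h1 := eq_envelope_of_inner_eq hK.isCompact hK.contDiff h (inner_tangentPoint_dirN _ φ t)
  have h2 := inner_tangentPoint_dirT (supportFun K) φ t
  rw [h1, inner_envelope_dirT] at h2
  linarith

theorem exists_supportFun_lt_inner {K : Set Plane} (hK : IsStrictlyConvexC2 K) {P : Plane}
    (hP : P ∉ K) : ∃ θ, supportFun K θ < inner ℝ P (dirN θ) := by
  rw [mem_iff_forall_inner_le hK.nonempty hK.isCompact hK.convex] at hP
  push Not at hP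
  exact hP

/-- Some support line, with normal angle `θ`, separates `P` from `K`, and the opposite one, at `θ -
π`, has `P` strictly on its inner side. In between a support line passes through `P`. The distance
`t` on it cannot be `≤ 0`, because then `P` would not be beyond the line at `θ`. -/
theorem exists_eq_tangentPoint {K : Set Plane} (hK : IsStrictlyConvexC2 K) {P : Plane}
    (hP : P ∉ K) : ∃ φ ∈ Ico 0 (2 * Real.pi), ∃ t, 0 < t ∧ P = tangentPoint (supportFun K) φ t := by
  obtain ⟨θ, hθ⟩ := exists_supportFun_lt_inner hK hP
  have hpi := Real.pi_pos
  have hper := supportFun_periodic K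
  have hcN : Continuous dirN :=
    continuous_iff_continuousAt.2 fun x => (hasDerivAt_dirN x).continuousAt
  have hu : Continuous fun s => supportFun K s - inner ℝ P (dirN s) :=
    hK.contDiff.continuous.sub (continuous_const.inner hcN)
  -- The gap at `τ = π` is the width `p(θ) + p(θ-π)`, so this says that the width is positive.
  have hg := supportGap_pos hK.contDiff hper hK.radius_pos (θ - Real.pi) (τ := Real.pi) hpi.ne'
    (by rw [abs_of_pos hpi]; linarith)
  rw [supportGap, sub_add_cancel, Real.cos_pi, Real.sin_pi] at hg
  have hN : dirN (θ - Real.pi) = -dirN θ := plane_ext (by simp) (by simp)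
  have h1 : 0 < supportFun K (θ - Real.pi) - inner ℝ P (dirN (θ - Real.pi)) := by
    rw [hN, inner_neg_right]
    linarith
  obtain ⟨φ, ⟨hφ1, hφ2⟩, hφ⟩ := intermediate_value_Icc' (by linarith : θ - Real.pi ≤ θ)
    hu.continuousOn ⟨(by linarith : supportFun K θ - inner ℝ P (dirN θ) ≤ 0), h1.le⟩
  simp only [sub_eq_zero] at hφ
  have hne : φ ≠ θ := by
    rintro rfl
    linarith
  have hlt : 0 < θ - φ := by
    have := lt_of_le_of_ne hφ2 hne
    linarith
  have hPt := eq_tangentPoint hφ.symm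
  set t := inner ℝ P (dirT φ) - deriv (supportFun K) φ with ht
  have ht0 : 0 < t := by
    by_contra hcon
    have e := sub_inner_tangentPoint (supportFun K) φ t (θ - φ)
    rw [← hPt, add_sub_cancel] at e
    have := supportGap_pos_of_pos hK.contDiff hK.radius_pos φ hlt (by linarith)
    have := mul_nonneg (neg_nonneg.2 (not_lt.1 hcon))
      (Real.sin_nonneg_of_nonneg_of_le_pi hlt.le (by linarith))
    linarith
  obtain ⟨ψ, hψ, he⟩ := (tangentPoint_periodic hper t).exists_mem_Ico₀ (by positivity) φ
  exact ⟨ψ, hψ, t, ht0, hPt.trans he⟩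

/-! ### The length of a tangent in terms of the angle between the two tangents -/

/-- The length of the tangent with normal angle `φ` up to its intersection with the tangent with
normal angle `φ + τ`. -/
def tangentLength (f : ℝ → ℝ) (φ τ : ℝ) : ℝ := supportGap f φ τ / Real.sin τ

/-- The `φ`-derivative is left unspecified because the Jacobian of the tangent coordinates does not
involve it. -/
theorem hasFDerivAt_supportGap {f : ℝ → ℝ} (hf : ContDiff ℝ 2 f) (x : ℝ × ℝ) :
    ∃ a : ℝ, HasFDerivAt (fun x : ℝ × ℝ => supportGap f x.1 x.2)
      (a • ContinuousLinearMap.fst ℝ ℝ ℝ + (deriv f (x.1 + x.2) + f x.1 * Real.sin x.2 -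
        deriv f x.1 * Real.cos x.2) • ContinuousLinearMap.snd ℝ ℝ ℝ) x := by
  have hfst : HasFDerivAt (fun x : ℝ × ℝ => x.1) (ContinuousLinearMap.fst ℝ ℝ ℝ) x :=
    hasFDerivAt_fst
  have hsnd : HasFDerivAt (fun x : ℝ × ℝ => x.2) (ContinuousLinearMap.snd ℝ ℝ ℝ) x :=
    hasFDerivAt_snd
  have h1 : HasFDerivAt (fun x : ℝ × ℝ => f (x.1 + x.2)) _ x :=
    (hasDerivAt_of_contDiff hf (x.1 + x.2)).comp_hasFDerivAt x (hfst.add hsnd)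
  have h2 : HasFDerivAt (fun x : ℝ × ℝ => f x.1) _ x :=
    (hasDerivAt_of_contDiff hf x.1).comp_hasFDerivAt x hfst
  have h3 : HasFDerivAt (fun x : ℝ × ℝ => deriv f x.1) _ x :=
    (hasDerivAt_deriv_of_contDiff hf x.1).comp_hasFDerivAt x hfst
  have h4 : HasFDerivAt (fun x : ℝ × ℝ => Real.cos x.2) _ x :=
    (Real.hasDerivAt_cos x.2).comp_hasFDerivAt x hsnd
  have h5 : HasFDerivAt (fun x : ℝ × ℝ => Real.sin x.2) _ x :=
    (Real.hasDerivAt_sin x.2).comp_hasFDerivAt x hsnd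
  refine ⟨deriv f (x.1 + x.2) - deriv f x.1 * Real.cos x.2 - deriv (deriv f) x.1 * Real.sin x.2,
    ((h1.sub (h2.mul h4)).sub (h3.mul h5)).congr_fderiv ?_⟩
  ext
  · simp; ring
  · simp

/-- The right-hand side is the numerator of the `τ`-derivative of `supportGap f φ τ / sin τ`. Thus
the length of one tangent grows at the rate given by the length of the other tangent divided by `sin
τ`, which is positive. -/
theorem supportGap_reverse (f : ℝ → ℝ) (φ τ : ℝ) : supportGap f (φ + τ) (-τ) =
    (deriv f (φ + τ) + f φ * Real.sin τ - deriv f φ * Real.cos τ) * Real.sin τ -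
      supportGap f φ τ * Real.cos τ := by
  rw [supportGap, supportGap, add_neg_cancel_right, Real.cos_neg, Real.sin_neg]
  linear_combination -f φ * Real.sin_sq_add_cos_sq τ

theorem hasFDerivAt_tangentLength {f : ℝ → ℝ} (hf : ContDiff ℝ 2 f) {x : ℝ × ℝ}
    (hx : Real.sin x.2 ≠ 0) :
    ∃ a : ℝ, HasFDerivAt (fun x : ℝ × ℝ => tangentLength f x.1 x.2)
      (a • ContinuousLinearMap.fst ℝ ℝ ℝ + (supportGap f (x.1 + x.2) (-x.2) / Real.sin x.2 ^ 2) •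
        ContinuousLinearMap.snd ℝ ℝ ℝ) x := by
  obtain ⟨a, ha⟩ := hasFDerivAt_supportGap hf x
  have h5 : HasFDerivAt (fun x : ℝ × ℝ => (Real.sin x.2)⁻¹) _ x :=
    ((Real.hasDerivAt_sin x.2).inv hx).comp_hasFDerivAt x
      (hasFDerivAt_snd (𝕜 := ℝ) (E := ℝ) (F := ℝ))
  have h6 := ha.mul h5
  have e : (fun x : ℝ × ℝ => tangentLength f x.1 x.2) =
      fun x : ℝ × ℝ => supportGap f x.1 x.2 * (Real.sin x.2)⁻¹ :=
    funext fun x => div_eq_mul_inv _ _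
  rw [e]
  refine ⟨a / Real.sin x.2, h6.congr_fderiv ?_⟩
  rw [supportGap_reverse]
  ext
  · simp; field_simp
  · simp; field_simp; ring

theorem hasDerivAt_tangentLength {f : ℝ → ℝ} (hf : ContDiff ℝ 2 f) (φ : ℝ) {τ : ℝ}
    (hτ : Real.sin τ ≠ 0) :
    HasDerivAt (tangentLength f φ) (supportGap f (φ + τ) (-τ) / Real.sin τ ^ 2) τ := by
  obtain ⟨a, ha⟩ := hasFDerivAt_tangentLength hf (x := (φ, τ)) hτ
  have h2 : HasDerivAt (fun s : ℝ => (φ, s)) (0, 1) τ :=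
    (hasDerivAt_const τ φ).prodMk (hasDerivAt_id τ)
  exact (ha.comp_hasDerivAt τ h2).congr_deriv (by simp)

theorem strictMonoOn_tangentLength {f : ℝ → ℝ} (hf : ContDiff ℝ 2 f)
    (hpos : ∀ x, 0 < f x + deriv (deriv f) x) (φ : ℝ) :
    StrictMonoOn (tangentLength f φ) (Ioo 0 Real.pi) := by
  have hs : ∀ τ ∈ Ioo 0 Real.pi, Real.sin τ ≠ 0 := fun τ h => (Real.sin_pos_of_mem_Ioo h).ne'
  apply strictMonoOn_of_deriv_pos (convex_Ioo _ _)
    fun τ h => (hasDerivAt_tangentLength hf φ (hs τ h)).continuousAt.continuousWithinAt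
  intro τ h
  rw [interior_Ioo] at h
  rw [(hasDerivAt_tangentLength hf φ (hs τ h)).deriv]
  exact div_pos (supportGap_pos_of_neg hf hpos _ (by linarith [h.1]) (by linarith [h.2]))
    (pow_pos (Real.sin_pos_of_mem_Ioo h) 2)

theorem tangentLength_pos {f : ℝ → ℝ} (hf : ContDiff ℝ 2 f)
    (hpos : ∀ x, 0 < f x + deriv (deriv f) x) (φ : ℝ) {τ : ℝ} (hτ : τ ∈ Ioo 0 Real.pi) :
    0 < tangentLength f φ τ :=
  div_pos (supportGap_pos_of_pos hf hpos φ hτ.1 hτ.2.le) (Real.sin_pos_of_mem_Ioo hτ)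

/-- For `P` at distance `t` on the tangent at `φ`, the function `v τ = supportGap - t sin τ` is the
signed distance of `P` from the support line at `φ + τ`. It is negative somewhere since `P ∉ K`, and
this can only happen in `(0, π)`, where the sine is positive. At `π` it is positive again, so it has
a zero. -/
theorem exists_tangentLength_eq {K : Set Plane} (hK : IsStrictlyConvexC2 K) (φ : ℝ) {t : ℝ}
    (ht : 0 < t) : ∃ τ ∈ Ioo 0 Real.pi, tangentLength (supportFun K) φ τ = t := by
  obtain ⟨θ, hθ⟩ := exists_supportFun_lt_inner hK (tangentPoint_notMem hK φ ht)
  have hper := supportFun_periodic K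
  have hpi := Real.pi_pos
  set v : ℝ → ℝ := fun τ => supportGap (supportFun K) φ τ - t * Real.sin τ with hv
  have hvc : Continuous v := by
    have := (continuous_supportGap hK.contDiff).comp (Continuous.prodMk_right φ)
    exact this.sub (by fun_prop)
  have hvper : Function.Periodic v (2 * Real.pi) := fun τ => by
    simp only [hv, supportGap, Real.cos_add_two_pi, Real.sin_add_two_pi, ← add_assoc, hper _]
  have hvθ : v (θ - φ) < 0 := by
    have := sub_inner_tangentPoint (supportFun K) φ t (θ - φ)
    rw [add_sub_cancel] at this
    simp only [hv, ← this]
    linarith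
  obtain ⟨σ, hσ, he⟩ := hvper.exists_mem_Ico₀ (by positivity) (θ - φ)
  rw [he] at hvθ
  have hσ0 : σ ≠ 0 := by
    rintro rfl
    simp [hv, supportGap] at hvθ
  have hσ0' : 0 < σ := lt_of_le_of_ne hσ.1 hσ0.symm
  have hσpi : σ < Real.pi := by
    by_contra hcon
    have h1 := supportGap_pos hK.contDiff hper hK.radius_pos φ hσ0
      (by rw [abs_of_pos hσ0']; exact hσ.2)
    have h2 : Real.sin σ ≤ 0 := by
      rw [← Real.sin_sub_two_pi]
      exact Real.sin_nonpos_of_nonpos_of_neg_pi_le (by linarith [hσ.2]) (by linarith)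
    have := mul_nonneg ht.le (neg_nonneg.2 h2)
    simp only [hv] at hvθ
    linarith
  have hvpi : 0 < v Real.pi := by
    have := supportGap_pos_of_pos hK.contDiff hK.radius_pos φ hpi le_rfl
    simp only [hv, Real.sin_pi]
    linarith
  obtain ⟨τ, ⟨hτ1, hτ2⟩, hτ⟩ := intermediate_value_Icc hσpi.le hvc.continuousOn ⟨hvθ.le, hvpi.le⟩
  have hne : τ ≠ Real.pi := by
    rintro rfl
    linarith
  have hmem : τ ∈ Ioo 0 Real.pi := ⟨by linarith, lt_of_le_of_ne hτ2 hne⟩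
  refine ⟨τ, hmem, ?_⟩
  rw [tangentLength, div_eq_iff (Real.sin_pos_of_mem_Ioo hmem).ne']
  simp only [hv] at hτ
  linarith

/-- The intersection of the tangents with normal angles `φ` and `φ + τ`. -/
def tangentMeet (f : ℝ → ℝ) (x : ℝ × ℝ) : Plane := tangentPoint f x.1 (tangentLength f x.1 x.2)

theorem tangentMeet_injOn {f : ℝ → ℝ} (hf : ContDiff ℝ 2 f)
    (hper : Function.Periodic f (2 * Real.pi)) (hpos : ∀ x, 0 < f x + deriv (deriv f) x) :
    InjOn (tangentMeet f) (Ico 0 (2 * Real.pi) ×ˢ Ioo 0 Real.pi) := by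
  rintro ⟨φ, τ⟩ ⟨hφ, hτ⟩ ⟨ψ, σ⟩ ⟨hψ, hσ⟩ h
  have := tangentPoint_injOn hf hper hpos
    (mk_mem_prod hφ (mem_Ioi.2 (tangentLength_pos hf hpos φ hτ)))
    (mk_mem_prod hψ (mem_Ioi.2 (tangentLength_pos hf hpos ψ hσ))) h
  simp only [Prod.mk.injEq] at this
  obtain ⟨rfl, h2⟩ := this
  exact congrArg (Prod.mk φ) ((strictMonoOn_tangentLength hf hpos φ).injOn hτ hσ h2)

theorem image_tangentMeet {K : Set Plane} (hK : IsStrictlyConvexC2 K) :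
    tangentMeet (supportFun K) '' (Ico 0 (2 * Real.pi) ×ˢ Ioo 0 Real.pi) = Kᶜ := by
  ext P
  constructor
  · rintro ⟨x, hx, rfl⟩
    exact tangentPoint_notMem hK _ (tangentLength_pos hK.contDiff hK.radius_pos _ hx.2)
  · intro hP
    obtain ⟨φ, hφ, t, ht, rfl⟩ := exists_eq_tangentPoint hK hP
    obtain ⟨τ, hτ, rfl⟩ := exists_tangentLength_eq hK φ ht
    exact ⟨(φ, τ), ⟨hφ, hτ⟩, rfl⟩

/-! ### The visual angle -/

theorem sub_inner_tangentMeet {f : ℝ → ℝ} (φ : ℝ) {τ : ℝ} (hτ : τ ∈ Ioo 0 Real.pi) :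
    inner ℝ (tangentMeet f (φ, τ)) (dirN (φ + τ)) = f (φ + τ) := by
  have := sub_inner_tangentPoint f φ (tangentLength f φ τ) τ
  rw [tangentLength, div_mul_cancel₀ _ (Real.sin_pos_of_mem_Ioo hτ).ne', sub_self, sub_eq_zero]
    at this
  exact this.symm

/-- A support line through `P` at normal angle `φ + σ`, `0 < σ < 2π`, satisfies `supportGap =
tangentLength · sin σ`. Positivity of the gap puts `σ` in `(0, π)`, and strict monotonicity of the
tangent length gives `σ = τ`. -/
theorem tangencyPoints_tangentMeet {K : Set Plane} (hK : IsStrictlyConvexC2 K) (φ : ℝ) {τ : ℝ}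
    (hτ : τ ∈ Ioo 0 Real.pi) : tangencyPoints K (tangentMeet (supportFun K) (φ, τ)) =
      {envelope (supportFun K) φ, envelope (supportFun K) (φ + τ)} := by
  have hper := supportFun_periodic K
  have hpi := Real.pi_pos
  set P := tangentMeet (supportFun K) (φ, τ) with hP
  have hN0 : ∀ θ, dirN θ ≠ 0 := fun θ h => by simpa [h] using norm_dirN θ
  have hmem : ∀ θ, inner ℝ P (dirN θ) = supportFun K θ →
      envelope (supportFun K) θ ∈ tangencyPoints K P := by
    intro θ hθ
    refine ⟨envelope_mem hK θ, dirN θ, hN0 θ, ?_, fun y hy => ?_⟩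
    · rw [real_inner_comm, inner_sub_left, inner_envelope_dirN, hθ, sub_self]
    · rw [real_inner_comm, inner_sub_left, hθ]
      linarith [inner_le_supportFun hK.isCompact hy θ]
  refine Subset.antisymm ?_ ?_
  · rintro x ⟨hx, u, hu0, hux, huy⟩
    obtain ⟨θ, hθ⟩ := exists_eq_norm_smul_dirN u
    have hn : 0 < ‖u‖ := norm_pos_iff.2 hu0
    rw [hθ, real_inner_smul_left, mul_eq_zero, or_iff_right hn.ne', real_inner_comm,
      inner_sub_left, sub_eq_zero] at hux
    obtain ⟨y, hy, hyp⟩ := exists_inner_eq_supportFun hK.isCompact hK.nonempty θ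
    have h1 := huy y hy
    rw [hθ, real_inner_smul_left, real_inner_comm, inner_sub_left, hyp] at h1
    -- The line through `P` and `x` with normal angle `θ` has `K` on one side. Since `x ∈ K` lies on
    -- it, it is the support line at `θ`.
    have h2 : supportFun K θ - inner ℝ P (dirN θ) ≤ 0 :=
      nonpos_of_mul_nonpos_right h1 hn
    have h3 := inner_le_supportFun hK.isCompact hx θ
    have hPθ : supportFun K θ - inner ℝ P (dirN θ) = 0 := by linarith
    have hxe : x = envelope (supportFun K) θ :=
      eq_envelope_of_inner_eq hK.isCompact hK.contDiff hx (by linarith)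
    -- reduce `θ - φ` to a number `σ` in one period
    have hperiodic : Function.Periodic (fun s => (envelope (supportFun K) (φ + s),
        supportFun K (φ + s) - inner ℝ P (dirN (φ + s)))) (2 * Real.pi) := fun s => by
      simp only [← add_assoc, envelope_periodic hper _, hper _, dirN_periodic _]
    obtain ⟨σ, hσ, he⟩ := hperiodic.exists_mem_Ico₀ (by positivity) (θ - φ)
    simp only [add_sub_cancel, Prod.mk.injEq] at he
    rw [hxe, he.1]
    rcases eq_or_ne σ 0 with rfl | hσ0
    · left
      rw [add_zero]
    · right
      rw [mem_singleton_iff]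
      have hσ0' : 0 < σ := lt_of_le_of_ne hσ.1 hσ0.symm
      have e := sub_inner_tangentPoint (supportFun K) φ (tangentLength (supportFun K) φ τ) σ
      have e' : supportGap (supportFun K) φ σ - tangentLength (supportFun K) φ τ * Real.sin σ = 0 :=
        e.symm.trans (he.2.symm.trans hPθ)
      have hg := supportGap_pos hK.contDiff hper hK.radius_pos φ hσ0
        (by rw [abs_of_pos hσ0']; exact hσ.2)
      have htl := tangentLength_pos hK.contDiff hK.radius_pos φ hτ
      have hsin : 0 < Real.sin σ := pos_of_mul_pos_right (by linarith) htl.le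
      have hσpi : σ < Real.pi := by
        by_contra hcon
        have h2 : Real.sin σ ≤ 0 := by
          rw [← Real.sin_sub_two_pi]
          exact Real.sin_nonpos_of_nonpos_of_neg_pi_le (by linarith [hσ.2]) (by linarith)
        linarith
      have : σ = τ := by
        refine (strictMonoOn_tangentLength hK.contDiff hK.radius_pos φ).injOn ⟨hσ0', hσpi⟩ hτ ?_
        rw [tangentLength, div_eq_iff hsin.ne']
        linarith
      rw [this]
  · rintro x (rfl | rfl)
    · exact hmem φ (inner_tangentPoint_dirN _ _ _)
    · exact hmem (φ + τ) (sub_inner_tangentMeet φ hτ)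

/-- From `P` the tangency points lie in the directions `-dirT φ` and `dirT (φ + τ)`, which make the
angle `π - τ`. The other pairs in the supremum are coincident points and contribute `0`. -/
theorem visualAngle_tangentMeet {K : Set Plane} (hK : IsStrictlyConvexC2 K) (φ : ℝ) {τ : ℝ}
    (hτ : τ ∈ Ioo 0 Real.pi) :
    visualAngle K (tangentMeet (supportFun K) (φ, τ)) = Real.pi - τ := by
  have hpi := Real.pi_pos
  rw [visualAngle, tangencyPoints_tangentMeet hK φ hτ]
  have hl := tangentLength_pos hK.contDiff hK.radius_pos φ hτ
  set p := supportFun K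
  set P := tangentMeet p (φ, τ) with hP
  have hPK : P ∉ K := tangentPoint_notMem hK _ hl
  -- Needed because an angle with a zero side has the default value `π/2` instead of `0`.
  have hne : ∀ θ, envelope p θ ≠ P := fun θ h => hPK (h ▸ envelope_mem hK θ)
  have hself : ∀ θ, EuclideanGeometry.angle (envelope p θ) P (envelope p θ) = 0 :=
    fun θ => EuclideanGeometry.angle_self_of_ne (hne θ)
  have hv1 : envelope p φ - P = tangentLength p φ τ • -dirT φ := by
    rw [hP, tangentMeet, tangentPoint]
    module
  have hP2 := eq_tangentPoint (sub_inner_tangentMeet (f := p) φ hτ)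
  rw [← hP] at hP2
  set s := inner ℝ P (dirT (φ + τ)) - deriv p (φ + τ) with hs
  have hv2 : envelope p (φ + τ) - P = -s • dirT (φ + τ) := by
    rw [hP2, tangentPoint]
    module
  have hs0 : 0 < -s := by
    have e := sub_inner_tangentPoint p (φ + τ) s (-τ)
    rw [add_neg_cancel_right, ← hP2, hP, tangentMeet, inner_tangentPoint_dirN, sub_self,
      Real.sin_neg] at e
    have hg := supportGap_pos_of_neg hK.contDiff hK.radius_pos (φ + τ) (τ := -τ)
      (by linarith [hτ.1]) (by linarith [hτ.2])
    have h0 : 0 < -s * Real.sin τ := by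
      change 0 < supportGap p (φ + τ) (-τ) at hg
      linarith
    exact pos_of_mul_pos_left h0 (Real.sin_pos_of_mem_Ioo hτ).le
  have hang : EuclideanGeometry.angle (envelope p φ) P (envelope p (φ + τ)) = Real.pi - τ := by
    rw [EuclideanGeometry.angle, vsub_eq_sub, vsub_eq_sub, hv1, hv2,
      InnerProductGeometry.angle_smul_left_of_pos _ _ hl,
      InnerProductGeometry.angle_smul_right_of_pos _ _ hs0, InnerProductGeometry.angle_neg_left,
      InnerProductGeometry.angle, norm_dirT, norm_dirT]
    have : inner ℝ (dirT φ) (dirT (φ + τ)) = Real.cos τ := by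
      simp only [inner_dirT, dirT_zero, dirT_one, Real.cos_add, Real.sin_add]
      linear_combination Real.cos τ * Real.sin_sq_add_cos_sq φ
    rw [this, mul_one, div_one, Real.arccos_cos hτ.1.le hτ.2.le]
  apply le_antisymm
  · refine csSup_le ⟨_, _, Or.inl rfl, _, Or.inl rfl, rfl⟩ ?_
    rintro a ⟨x, rfl | rfl, y, rfl | rfl, rfl⟩
    · rw [hself]; linarith [hτ.2]
    · rw [hang]
    · rw [EuclideanGeometry.angle_comm, hang]
    · rw [hself]; linarith [hτ.2]
  · refine le_csSup ⟨Real.pi, ?_⟩ ⟨_, Or.inl rfl, _, Or.inr rfl, hang.symm⟩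
    rintro a ⟨x, -, y, -, rfl⟩
    exact EuclideanGeometry.angle_le_pi _ _ _

/-! ### Change of variables -/

/-- The plane as a product of two lines. -/
def planeEquiv : ℝ × ℝ ≃ᵐ Plane :=
  MeasurableEquiv.finTwoArrow.symm.trans (MeasurableEquiv.toLp 2 (Fin 2 → ℝ))

theorem planeEquiv_apply (x : ℝ × ℝ) : planeEquiv x = !₂[x.1, x.2] := rfl

theorem planeEquiv_coords (v : Plane) : planeEquiv (v 0, v 1) = v := by
  rw [planeEquiv_apply]
  exact plane_ext (by simp) (by simp)

theorem measurePreserving_planeEquiv : MeasurePreserving planeEquiv volume volume :=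
  (PiLp.volume_preserving_toLp (Fin 2)).comp (volume_preserving_finTwoArrow ℝ).symm

/-- The distance along the tangent is an arbitrary function of both parameters with partial
derivatives `a`, `b`. It is used with `tangentLength` for the angle integral and with a rescaled
distance for the area. -/
theorem hasFDerivAt_planeEquiv_symm_tangentPoint {f : ℝ → ℝ} (hf : ContDiff ℝ 2 f)
    {t : ℝ × ℝ → ℝ} {a b : ℝ} {x : ℝ × ℝ}
    (ht : HasFDerivAt t (a • ContinuousLinearMap.fst ℝ ℝ ℝ + b • ContinuousLinearMap.snd ℝ ℝ ℝ) x) :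
    HasFDerivAt (fun x : ℝ × ℝ => (tangentPoint f x.1 (t x) 0, tangentPoint f x.1 (t x) 1))
      (Matrix.toLin (.finTwoProd ℝ) (.finTwoProd ℝ)
        !![-((f x.1 + deriv (deriv f) x.1 + a) * Real.sin x.1) - t x * Real.cos x.1,
            -(b * Real.sin x.1);
          (f x.1 + deriv (deriv f) x.1 + a) * Real.cos x.1 - t x * Real.sin x.1,
            b * Real.cos x.1]).toContinuousLinearMap x := by
  rw [Matrix.toLin_finTwoProd_toContinuousLinearMap]
  have hfst : HasFDerivAt (fun x : ℝ × ℝ => x.1) (ContinuousLinearMap.fst ℝ ℝ ℝ) x :=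
    hasFDerivAt_fst
  have hf0 : HasFDerivAt (fun x : ℝ × ℝ => f x.1) _ x :=
    (hasDerivAt_of_contDiff hf x.1).comp_hasFDerivAt x hfst
  have hf1 : HasFDerivAt (fun x : ℝ × ℝ => deriv f x.1 + t x) _ x :=
    ((hasDerivAt_deriv_of_contDiff hf x.1).comp_hasFDerivAt x hfst).add ht
  have hc : HasFDerivAt (fun x : ℝ × ℝ => Real.cos x.1) _ x :=
    (Real.hasDerivAt_cos x.1).comp_hasFDerivAt x hfst
  have hs : HasFDerivAt (fun x : ℝ × ℝ => Real.sin x.1) _ x :=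
    (Real.hasDerivAt_sin x.1).comp_hasFDerivAt x hfst
  have e : (fun x : ℝ × ℝ => (tangentPoint f x.1 (t x) 0, tangentPoint f x.1 (t x) 1)) =
      fun x : ℝ × ℝ => (f x.1 * Real.cos x.1 - (deriv f x.1 + t x) * Real.sin x.1,
        f x.1 * Real.sin x.1 + (deriv f x.1 + t x) * Real.cos x.1) := by
    funext x
    simp only [tangentPoint, envelope, PiLp.add_apply, PiLp.smul_apply, smul_eq_mul, dirN_zero,
      dirN_one, dirT_zero, dirT_one]
    ext <;> simp <;> ring
  rw [e]
  refine (((hf0.mul hc).sub (hf1.mul hs)).prodMk ((hf0.mul hs).add (hf1.mul hc))).congr_fderiv ?_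
  ext <;> simp <;> ring

section ChangeOfVariables

variable {f : ℝ → ℝ} {t a b : ℝ × ℝ → ℝ} {s : Set (ℝ × ℝ)}

/-- Sliding along the tangent sweeps no area, so the radius of curvature `r` and the partial
derivative `a` drop out. -/
theorem det_fderiv_tangentPoint (φ r a b t : ℝ) :
    (Matrix.toLin (.finTwoProd ℝ) (.finTwoProd ℝ)
        !![-((r + a) * Real.sin φ) - t * Real.cos φ, -(b * Real.sin φ);
          (r + a) * Real.cos φ - t * Real.sin φ, b * Real.cos φ]).toContinuousLinearMap.det =
      -(t * b) := by
  simp only [LinearMap.det_toContinuousLinearMap, LinearMap.det_toLin, Matrix.det_fin_two_of]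
  linear_combination -t * b * Real.sin_sq_add_cos_sq φ

theorem preimage_image_tangentPoint :
    planeEquiv ⁻¹' ((fun x : ℝ × ℝ => tangentPoint f x.1 (t x)) '' s) =
      (fun x : ℝ × ℝ => (tangentPoint f x.1 (t x) 0, tangentPoint f x.1 (t x) 1)) '' s := by
  ext y
  simp only [mem_preimage, mem_image]
  refine exists_congr fun x => and_congr_right fun _ => ?_
  rw [planeEquiv_apply]
  constructor
  · intro h
    rw [h]
    simp
  · rintro rfl
    exact plane_ext (by simp) (by simp)

theorem integrableOn_image_tangentPoint_iff
    (hf : ContDiff ℝ 2 f) (hs : MeasurableSet s)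
    (ht : ∀ x ∈ s, HasFDerivAt t
      (a x • ContinuousLinearMap.fst ℝ ℝ ℝ + b x • ContinuousLinearMap.snd ℝ ℝ ℝ) x)
    (hinj : InjOn (fun x : ℝ × ℝ => tangentPoint f x.1 (t x)) s) (G : Plane → ℝ) :
    IntegrableOn G ((fun x : ℝ × ℝ => tangentPoint f x.1 (t x)) '' s) ↔
      IntegrableOn (fun x => |t x * b x| * G (tangentPoint f x.1 (t x))) s := by
  rw [← measurePreserving_planeEquiv.integrableOn_comp_preimage planeEquiv.measurableEmbedding,
    preimage_image_tangentPoint, integrableOn_image_iff_integrableOn_abs_det_fderiv_smul volume hs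
      (fun x hx => (hasFDerivAt_planeEquiv_symm_tangentPoint hf (ht x hx)).hasFDerivWithinAt)]
  · simp_rw [det_fderiv_tangentPoint, abs_neg, smul_eq_mul, Function.comp_apply,
      planeEquiv_coords]
  · intro x hx y hy h
    simp only [Prod.mk.injEq] at h
    exact hinj hx hy (plane_ext h.1 h.2)

theorem integral_image_tangentPoint
    (hf : ContDiff ℝ 2 f) (hs : MeasurableSet s)
    (ht : ∀ x ∈ s, HasFDerivAt t
      (a x • ContinuousLinearMap.fst ℝ ℝ ℝ + b x • ContinuousLinearMap.snd ℝ ℝ ℝ) x)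
    (hinj : InjOn (fun x : ℝ × ℝ => tangentPoint f x.1 (t x)) s) (G : Plane → ℝ) :
    ∫ P in (fun x : ℝ × ℝ => tangentPoint f x.1 (t x)) '' s, G P =
      ∫ x in s, |t x * b x| * G (tangentPoint f x.1 (t x)) := by
  rw [← measurePreserving_planeEquiv.setIntegral_preimage_emb planeEquiv.measurableEmbedding,
    preimage_image_tangentPoint, integral_image_eq_integral_abs_det_fderiv_smul volume hs
      (fun x hx => (hasFDerivAt_planeEquiv_symm_tangentPoint hf (ht x hx)).hasFDerivWithinAt)]
  · simp_rw [det_fderiv_tangentPoint, abs_neg, smul_eq_mul, planeEquiv_coords]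
  · intro x hx y hy h
    simp only [Prod.mk.injEq] at h
    exact hinj hx hy (plane_ext h.1 h.2)

end ChangeOfVariables

/-! ### Length and area -/

theorem integral_deriv_period {f : ℝ → ℝ} (hf : ContDiff ℝ 2 f)
    (hper : Function.Periodic f (2 * Real.pi)) :
    ∫ φ in (0 : ℝ)..(2 * Real.pi), deriv (deriv f) φ = 0 := by
  rw [intervalIntegral.integral_eq_sub_of_hasDerivAt
    (fun φ _ => hasDerivAt_deriv_of_contDiff hf φ)
    ((continuous_deriv_deriv_of_contDiff hf).intervalIntegrable _ _)]
  simpa [sub_eq_zero] using periodic_deriv hper 0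

theorem boundaryLength_eq {K : Set Plane} (hK : IsStrictlyConvexC2 K) :
    boundaryLength K = ∫ φ in (0 : ℝ)..(2 * Real.pi), supportFun K φ := by
  have h : ∀ φ, ‖deriv (envelope (supportFun K)) φ‖ =
      supportFun K φ + deriv (deriv (supportFun K)) φ := fun φ => by
    rw [(hasDerivAt_envelope hK.contDiff φ).deriv, norm_smul, norm_dirT, mul_one,
      Real.norm_of_nonneg (hK.radius_pos φ).le]
  simp_rw [boundaryLength, h]
  rw [intervalIntegral.integral_add (hK.contDiff.continuous.intervalIntegrable _ _)
    ((continuous_deriv_deriv_of_contDiff hK.contDiff).intervalIntegrable _ _),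
    integral_deriv_period hK.contDiff (supportFun_periodic K), add_zero]

theorem norm_sq_eq_inner (x : Plane) (φ : ℝ) :
    ‖x‖ ^ 2 = inner ℝ x (dirN φ) ^ 2 + inner ℝ x (dirT φ) ^ 2 := by
  rw [EuclideanSpace.norm_sq_eq, Fin.sum_univ_two, inner_dirN, inner_dirT, Real.norm_eq_abs,
    Real.norm_eq_abs, sq_abs, sq_abs]
  linear_combination -(x 0 ^ 2 + x 1 ^ 2) * Real.sin_sq_add_cos_sq φ

theorem integral_deriv_mul_comp_period {f g : ℝ → ℝ} (hf : ContDiff ℝ 2 f) (hg : Continuous g)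
    (hper : Function.Periodic f (2 * Real.pi)) :
    ∫ φ in (0 : ℝ)..(2 * Real.pi), g (f φ) * deriv f φ = 0 := by
  have := intervalIntegral.integral_comp_mul_deriv (a := 0) (b := 2 * Real.pi)
    (fun φ _ => hasDerivAt_of_contDiff hf φ) (continuous_deriv_of_contDiff hf).continuousOn hg
  have h0 : f (2 * Real.pi) = f 0 := by simpa using hper 0
  rw [h0, intervalIntegral.integral_same] at this
  exact this

/-- The tangent segments sweep out the complement of `K` in a large disk of radius `R`. Its area is
`½ ∫ s²`, where `s = √(R² - p²) - p'` is the distance along the tangent to the circle. In `s²` the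
cross term `√(R² - p²) p'` is a total derivative and integrates to `0`, which leaves `2R² π - ∫ (p²
- p'²)`. -/
theorem volume_real_eq {K : Set Plane} (hK : IsStrictlyConvexC2 K) :
    volume.real K = signedArea (supportFun K) := by
  have hpi := Real.pi_pos
  set p := supportFun K with hp
  have hper : Function.Periodic p (2 * Real.pi) := supportFun_periodic K
  have hf : ContDiff ℝ 2 p := hK.contDiff
  obtain ⟨R, hR, hKR⟩ : ∃ R > 0, K ⊆ Metric.ball 0 R :=
    hK.isCompact.isBounded.subset_ball_lt 0 0
  have hlt : ∀ φ, p φ ^ 2 + deriv p φ ^ 2 < R ^ 2 := fun φ => by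
    have h := mem_ball_zero_iff.1 (hKR (envelope_mem hK φ))
    have h2 := norm_sq_eq_inner (envelope p φ) φ
    rw [inner_envelope_dirN, inner_envelope_dirT] at h2
    rw [← h2]
    exact pow_lt_pow_left₀ h (norm_nonneg _) two_ne_zero
  have hpos : ∀ φ, 0 < R ^ 2 - p φ ^ 2 := fun φ => by nlinarith [hlt φ, sq_nonneg (deriv p φ)]
  set s : ℝ → ℝ := fun φ => √(R ^ 2 - p φ ^ 2) - deriv p φ with hs
  have hs0 : ∀ φ, 0 < s φ := fun φ => by
    have : deriv p φ < √(R ^ 2 - p φ ^ 2) := Real.lt_sqrt_of_sq_lt (by linarith [hlt φ])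
    simp only [hs]
    linarith
  have hball : ∀ φ t, 0 < t → (tangentPoint p φ t ∈ Metric.ball (0 : Plane) R ↔ t < s φ) := by
    intro φ t ht
    rw [mem_ball_zero_iff, ← sq_lt_sq₀ (norm_nonneg _) hR.le, norm_sq_eq_inner _ φ,
      inner_tangentPoint_dirN, inner_tangentPoint_dirT, ← lt_sub_iff_add_lt']
    have h1 : -√(R ^ 2 - p φ ^ 2) < deriv p φ + t := by
      have : -√(R ^ 2 - p φ ^ 2) < deriv p φ := Real.neg_sqrt_lt_of_sq_lt (by linarith [hlt φ])
      linarith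
    simp only [hs]
    rw [Real.sq_lt, lt_sub_iff_add_lt']
    simp [h1]
  have hsd : ∀ φ, HasDerivAt s (deriv s φ) φ := fun φ => by
    refine DifferentiableAt.hasDerivAt (DifferentiableAt.sub (DifferentiableAt.sqrt ?_ (hpos φ).ne')
      (hasDerivAt_deriv_of_contDiff hf φ).differentiableAt)
    exact ((hasDerivAt_of_contDiff hf φ).differentiableAt.pow 2).const_sub _
  -- The distance is divided by `s φ` so that the parameter domain becomes a product.
  set D : Set (ℝ × ℝ) := Ico 0 (2 * Real.pi) ×ˢ Ioo 0 1 with hD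
  have himage : (fun x : ℝ × ℝ => tangentPoint p x.1 (s x.1 * x.2)) '' D =
      Metric.ball 0 R \ K := by
    ext P
    constructor
    · rintro ⟨x, ⟨hx1, hx2⟩, rfl⟩
      have h0 : 0 < s x.1 * x.2 := mul_pos (hs0 _) hx2.1
      refine ⟨(hball _ _ h0).2 ?_, tangentPoint_notMem hK _ h0⟩
      exact mul_lt_of_lt_one_right (hs0 _) hx2.2
    · rintro ⟨hPR, hPK⟩
      obtain ⟨φ, hφ, t, ht, rfl⟩ := exists_eq_tangentPoint hK hPK
      refine ⟨(φ, t / s φ), ⟨hφ, div_pos ht (hs0 φ), ?_⟩, ?_⟩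
      · exact (div_lt_one (hs0 φ)).2 ((hball _ _ ht).1 hPR)
      · simp only
        rw [mul_div_cancel₀ _ (hs0 φ).ne']
  have hinj : InjOn (fun x : ℝ × ℝ => tangentPoint p x.1 (s x.1 * x.2)) D := by
    rintro ⟨φ, y⟩ ⟨hφ, hy⟩ ⟨ψ, z⟩ ⟨hψ, hz⟩ h
    have := tangentPoint_injOn hf hper hK.radius_pos
      (mk_mem_prod hφ (mem_Ioi.2 (mul_pos (hs0 φ) hy.1)))
      (mk_mem_prod hψ (mem_Ioi.2 (mul_pos (hs0 ψ) hz.1))) h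
    simp only [Prod.mk.injEq] at this
    obtain ⟨rfl, h2⟩ := this
    exact congrArg (Prod.mk φ) (mul_left_cancel₀ (hs0 φ).ne' h2)
  have hmeas : MeasurableSet D := measurableSet_Ico.prod measurableSet_Ioo
  have key := integral_image_tangentPoint (t := fun x => s x.1 * x.2)
    (a := fun x => deriv s x.1 * x.2) (b := fun x => s x.1) hf hmeas
    (fun x _ => by
      have h1 : HasFDerivAt (fun x : ℝ × ℝ => s x.1) _ x :=
        (hsd x.1).comp_hasFDerivAt x (hasFDerivAt_fst (𝕜 := ℝ) (E := ℝ) (F := ℝ))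
      refine (h1.mul hasFDerivAt_snd).congr_fderiv ?_
      ext
      · simp [mul_comm]
      · simp) hinj (fun _ => 1)
  rw [himage] at key
  simp only [mul_one] at key
  rw [integral_const, smul_eq_mul, mul_one, measureReal_restrict_apply_univ,
    measureReal_sdiff hKR hK.isCompact.measurableSet] at key
  have hvol : volume.real (Metric.ball (0 : Plane) R) = Real.pi * R ^ 2 := by
    rw [Measure.real, EuclideanSpace.volume_ball_fin_two]
    simp [hR.le, hpi.le, ENNReal.toReal_ofReal, mul_comm]
  have hint : ∫ x in D, |s x.1 * x.2 * s x.1| = 1 / 2 * ∫ φ in (0 : ℝ)..(2 * Real.pi), s φ ^ 2 := by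
    have e : EqOn (fun x : ℝ × ℝ => |s x.1 * x.2 * s x.1|) (fun x => s x.1 ^ 2 * x.2) D := by
      intro x hx
      simp only
      rw [abs_of_pos (mul_pos (mul_pos (hs0 _) hx.2.1) (hs0 _))]
      ring
    rw [setIntegral_congr_fun hmeas e, hD, Measure.volume_eq_prod, setIntegral_prod_mul
      (fun φ => s φ ^ 2) (fun y => y), intervalIntegral.integral_of_le (by positivity),
      integral_Ico_eq_integral_Ioc, ← integral_Ioc_eq_integral_Ioo,
      ← intervalIntegral.integral_of_le (zero_le_one' ℝ), integral_id]
    ring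
  have hexp : ∫ φ in (0 : ℝ)..(2 * Real.pi), s φ ^ 2 =
      2 * Real.pi * R ^ 2 - ∫ φ in (0 : ℝ)..(2 * Real.pi), (p φ ^ 2 - deriv p φ ^ 2) := by
    have h0 := integral_deriv_mul_comp_period (g := fun x => √(R ^ 2 - x ^ 2)) hf (by fun_prop) hper
    have c0 := hf.continuous
    have c1 := continuous_deriv_of_contDiff hf
    have e : ∀ φ, s φ ^ 2 = R ^ 2 - (p φ ^ 2 - deriv p φ ^ 2) -
        2 * (√(R ^ 2 - p φ ^ 2) * deriv p φ) := fun φ => by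
      simp only [hs]
      linear_combination Real.sq_sqrt (hpos φ).le
    simp_rw [e]
    rw [intervalIntegral.integral_sub, intervalIntegral.integral_sub,
      intervalIntegral.integral_const_mul, h0, intervalIntegral.integral_const]
    · simp
    all_goals exact (by fun_prop : Continuous _).intervalIntegrable _ _
  rw [hvol, hint, hexp] at key
  rw [signedArea]
  linarith

/-! ### The function of the visual angle -/

theorem hasDerivAt_angleIntegrand (ω : ℝ) : HasDerivAt angleIntegrand
    (1 - 2 * Real.cos ω + 2 * Real.cos (2 * ω) - Real.cos (4 * ω) -
      3 * Real.sin ω ^ 2 * Real.cos ω) ω := by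
  have h2 : HasDerivAt (fun x : ℝ => 2 * x) 2 ω := by simpa using (hasDerivAt_id ω).const_mul 2
  have h4 : HasDerivAt (fun x : ℝ => 4 * x) 4 ω := by simpa using (hasDerivAt_id ω).const_mul 4
  have hs := Real.hasDerivAt_sin ω
  refine (((((hasDerivAt_id ω).sub (hs.const_mul 2)).add h2.sin).sub
    (h4.sin.const_mul (1 / 4))).sub (hs.pow 3)).congr_deriv ?_
  simp only [Nat.cast_ofNat, Nat.add_one_sub_one]
  ring

theorem cos_four_mul (x : ℝ) : Real.cos (4 * x) = 8 * Real.cos x ^ 4 - 8 * Real.cos x ^ 2 + 1 := by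
  rw [show 4 * x = 2 * (2 * x) by ring, Real.cos_two_mul, Real.cos_two_mul]
  ring

/-- The factor `1 - cos ω` makes the function of `ω` of third order at `0`, which gives convergence
at infinity, and cancels against `sin² ω` in the kernel. -/
theorem deriv_angleIntegrand_eq (ω : ℝ) :
    1 - 2 * Real.cos ω + 2 * Real.cos (2 * ω) - Real.cos (4 * ω) -
      3 * Real.sin ω ^ 2 * Real.cos ω =
    (1 - Real.cos ω) * (8 * Real.cos ω ^ 3 + 5 * Real.cos ω ^ 2 - 7 * Real.cos ω - 2) := by
  rw [cos_four_mul, Real.cos_two_mul, Real.sin_sq]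
  ring

theorem abs_deriv_angleIntegrand_le (ω : ℝ) :
    |(1 - Real.cos ω) * (8 * Real.cos ω ^ 3 + 5 * Real.cos ω ^ 2 - 7 * Real.cos ω - 2)| ≤
      22 * (1 - Real.cos ω) := by
  have h1 := Real.cos_le_one ω
  have h2 := Real.neg_one_le_cos ω
  rw [abs_mul, abs_of_nonneg (by linarith), mul_comm]
  -- The constant is `22 = 8 + 5 + 7 + 2`.
  refine mul_le_mul_of_nonneg_right ?_ (by linarith)
  have h3 : |Real.cos ω| ≤ 1 := Real.abs_cos_le_one ω
  have a2 : |5 * Real.cos ω ^ 2| ≤ 5 := by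
    rw [abs_mul, abs_pow, abs_of_pos (by norm_num : (0 : ℝ) < 5)]
    linarith [pow_le_one₀ (n := 2) (abs_nonneg _) h3]
  have a3 : |8 * Real.cos ω ^ 3| ≤ 8 := by
    rw [abs_mul, abs_pow, abs_of_pos (by norm_num : (0 : ℝ) < 8)]
    linarith [pow_le_one₀ (n := 3) (abs_nonneg _) h3]
  rw [abs_le] at *
  constructor <;> linarith

theorem abs_angleIntegrand_le {ω : ℝ} (hω : 0 ≤ ω) :
    |angleIntegrand ω| ≤ 22 * (ω - Real.sin ω) := by
  have h0 : angleIntegrand 0 = 0 := by simp [angleIntegrand]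
  have hd : ∀ x, HasDerivAt (fun x => 22 * (x - Real.sin x)) (22 * (1 - Real.cos x)) x :=
    fun x => ((hasDerivAt_id x).sub (Real.hasDerivAt_sin x)).const_mul 22
  -- Both signs of the absolute value at once: the derivative is nonnegative for `ε = 1` and `ε =
  -- -1`.
  have key : ∀ ε : ℝ, |ε| = 1 → 0 ≤ 22 * (ω - Real.sin ω) + ε * angleIntegrand ω := by
    intro ε hε
    have hm : Monotone fun x => 22 * (x - Real.sin x) + ε * angleIntegrand x := by
      refine monotone_of_hasDerivAt_nonneg
        (fun x => (hd x).add ((hasDerivAt_angleIntegrand x).const_mul ε)) fun x => ?_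
      rw [deriv_angleIntegrand_eq]
      have h1 := abs_deriv_angleIntegrand_le x
      set y := (1 - Real.cos x) * (8 * Real.cos x ^ 3 + 5 * Real.cos x ^ 2 - 7 * Real.cos x - 2)
      have h2 : |ε * y| = |y| := by rw [abs_mul, hε, one_mul]
      have h3 := neg_abs_le (ε * y)
      simp only [Pi.zero_apply]
      linarith
    have := hm hω
    simpa [h0] using this
  rw [abs_le]
  constructor
  · linarith [key 1 (by norm_num)]
  · linarith [key (-1) (by norm_num)]

theorem sub_sin_le_cube {ω : ℝ} (hω : 0 ≤ ω) : ω - Real.sin ω ≤ ω ^ 3 := by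
  have hm : MonotoneOn (fun x => x ^ 3 - (x - Real.sin x)) (Ici 0) := by
    refine monotoneOn_of_hasDerivWithinAt_nonneg (convex_Ici 0) (by fun_prop)
      (f' := fun x => 3 * x ^ 2 - (1 - Real.cos x)) (fun x _ => ?_) fun x _ => ?_
    · refine HasDerivAt.hasDerivWithinAt ?_
      refine ((hasDerivAt_pow 3 x).sub
        ((hasDerivAt_id x).sub (Real.hasDerivAt_sin x))).congr_deriv ?_
      norm_num
    · have := Real.one_sub_sq_div_two_le_cos (x := x)
      nlinarith [sq_nonneg x]
  have := hm self_mem_Ici hω hω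
  simp only [Real.sin_zero] at this
  linarith

/-- In half angles, `|g| ≤ 22 π³ sin³(ω/2)` and `(1 + cos ω)² ≤ 4 cos³(ω/2)`, and `8 sin³ cos³` of
the half angle is `sin³ ω`. With `ω = π - τ` the factor `(1 + cos ω)²` comes from the bounds for two
gaps. -/
theorem abs_angleIntegrand_mul_le {ω : ℝ} (h0 : 0 ≤ ω) (h1 : ω ≤ Real.pi) :
    |angleIntegrand ω| * (1 + Real.cos ω) ^ 2 ≤ 11 * Real.pi ^ 3 * Real.sin ω ^ 3 := by
  have hpi := Real.pi_pos
  have a1 : |angleIntegrand ω| ≤ 22 * ω ^ 3 :=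
    (abs_angleIntegrand_le h0).trans (by linarith [sub_sin_le_cube h0])
  have a2 : ω ≤ Real.pi * Real.sin (ω / 2) := by
    have := Real.mul_le_sin (x := ω / 2) (by linarith) (by linarith)
    calc ω = Real.pi * (2 / Real.pi * (ω / 2)) := by field_simp
      _ ≤ _ := mul_le_mul_of_nonneg_left this hpi.le
  have a3 : ω ^ 3 ≤ Real.pi ^ 3 * Real.sin (ω / 2) ^ 3 := by
    rw [← mul_pow]
    exact pow_le_pow_left₀ h0 a2 3
  have hs : 0 ≤ Real.sin (ω / 2) := Real.sin_nonneg_of_nonneg_of_le_pi (by linarith) (by linarith)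
  have hc : 0 ≤ Real.cos (ω / 2) := Real.cos_nonneg_of_neg_pi_div_two_le_of_le (by linarith)
    (by linarith)
  have a4 : 1 + Real.cos ω = 2 * Real.cos (ω / 2) ^ 2 := by
    have := Real.cos_two_mul (ω / 2)
    rw [mul_div_cancel₀ _ two_ne_zero] at this
    linarith
  have a5 : Real.sin ω = 2 * Real.sin (ω / 2) * Real.cos (ω / 2) := by
    have := Real.sin_two_mul (ω / 2)
    rwa [mul_div_cancel₀ _ two_ne_zero] at this
  have a6 : Real.cos (ω / 2) ^ 4 ≤ Real.cos (ω / 2) ^ 3 :=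
    pow_le_pow_of_le_one hc (Real.cos_le_one _) (by norm_num)
  rw [a4, a5]
  calc |angleIntegrand ω| * (2 * Real.cos (ω / 2) ^ 2) ^ 2
      ≤ (22 * (Real.pi ^ 3 * Real.sin (ω / 2) ^ 3)) * (4 * Real.cos (ω / 2) ^ 3) := by
        refine mul_le_mul (by linarith) ?_ (by positivity) (by positivity)
        calc _ = 4 * Real.cos (ω / 2) ^ 4 := by ring
          _ ≤ _ := by linarith
    _ = _ := by ring

theorem abs_angleIntegrand_pi_sub_mul_le {τ : ℝ} (hτ : τ ∈ Ioo 0 Real.pi) :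
    |angleIntegrand (Real.pi - τ)| * (1 - Real.cos τ) ^ 2 ≤ 11 * Real.pi ^ 3 * Real.sin τ ^ 3 := by
  have := abs_angleIntegrand_mul_le (ω := Real.pi - τ) (by linarith [hτ.2]) (by linarith [hτ.1])
  rwa [Real.cos_pi_sub, Real.sin_pi_sub, ← sub_eq_add_neg] at this

/-- The weight `g'(π - τ) / sin² τ`, where `g` is the function of the visual angle. -/
def angleKernel (τ : ℝ) : ℝ := 2 / (1 - Real.cos τ) + 3 * Real.cos τ + 4 * Real.cos (2 * τ)

theorem one_sub_cos_pos {τ : ℝ} (hτ : τ ∈ Ioo 0 Real.pi) : 0 < 1 - Real.cos τ := by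
  have := Real.cos_lt_cos_of_nonneg_of_le_pi le_rfl hτ.2.le hτ.1
  rw [Real.cos_zero] at this
  linarith

theorem hasDerivAt_angleIntegrand_pi_sub {τ : ℝ} (hτ : τ ∈ Ioo 0 Real.pi) :
    HasDerivAt (fun τ => angleIntegrand (Real.pi - τ)) (-(angleKernel τ * Real.sin τ ^ 2)) τ := by
  have h := (hasDerivAt_angleIntegrand (Real.pi - τ)).comp τ ((hasDerivAt_id τ).const_sub Real.pi)
  refine h.congr_deriv ?_
  have hc := (one_sub_cos_pos hτ).ne'
  rw [deriv_angleIntegrand_eq, Real.cos_pi_sub, angleKernel, Real.sin_sq, Real.cos_two_mul]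
  field_simp
  ring

theorem continuousOn_angleKernel : ContinuousOn angleKernel (Ioo 0 Real.pi) := by
  unfold angleKernel
  refine ContinuousOn.add (ContinuousOn.add ?_ (by fun_prop)) (by fun_prop)
  exact continuousOn_const.div (by fun_prop) fun τ hτ => (one_sub_cos_pos hτ).ne'

/-- The constant is `16 = 2 + (3 + 4) · 2`. -/
theorem abs_angleKernel_mul_le {τ : ℝ} (hτ : τ ∈ Ioo 0 Real.pi) :
    |angleKernel τ| * (1 - Real.cos τ) ≤ 16 := by
  have h := one_sub_cos_pos hτ
  have e : |angleKernel τ| * (1 - Real.cos τ) =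
      |2 + (3 * Real.cos τ + 4 * Real.cos (2 * τ)) * (1 - Real.cos τ)| := by
    rw [← abs_of_pos h, ← abs_mul, abs_of_pos h, angleKernel]
    congr 1
    field_simp
    ring
  have h1 := abs_le.1 (Real.abs_cos_le_one τ)
  have h2 := abs_le.1 (Real.abs_cos_le_one (2 * τ))
  rw [e, abs_le]
  constructor <;> nlinarith

/-! ### The angle integral along one tangent -/

section

variable {f : ℝ → ℝ}

theorem exists_radius_lt (hf : ContDiff ℝ 2 f) (hper : Function.Periodic f (2 * Real.pi)) :
    ∃ M : ℝ, ∀ x, f x + deriv (deriv f) x < M := by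
  have hc : Continuous fun x => f x + deriv (deriv f) x :=
    hf.continuous.add (continuous_deriv_deriv_of_contDiff hf)
  have hp : Function.Periodic (fun x => f x + deriv (deriv f) x) (2 * Real.pi) := fun x => by
    simp only [hper x, periodic_deriv (periodic_deriv hper) x]
  obtain ⟨M, hM⟩ := (isCompact_Icc (a := (0 : ℝ)) (b := 2 * Real.pi)).bddAbove_image hc.continuousOn
  refine ⟨M + 1, fun x => ?_⟩
  obtain ⟨y, hy, he⟩ := hp.exists_mem_Ico₀ (by positivity) x
  have := hM (mem_image_of_mem _ (Ico_subset_Icc_self hy))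
  linarith

/-- The integrand of the visual angle integral in the coordinates `tangentMeet`. -/
def angleDensity (f : ℝ → ℝ) (x : ℝ × ℝ) : ℝ :=
  tangentLength f x.1 x.2 * (supportGap f (x.1 + x.2) (-x.2) / Real.sin x.2 ^ 2) *
    angleIntegrand (Real.pi - x.2)

theorem abs_supportGap_le (hf : ContDiff ℝ 2 f) (hpos : ∀ x, 0 < f x + deriv (deriv f) x) {M : ℝ}
    (hM : ∀ x, f x + deriv (deriv f) x < M) (φ : ℝ) {τ : ℝ} (h0 : τ ≠ 0) (h1 : |τ| ≤ Real.pi) :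
    |supportGap f φ τ| ≤ M * (1 - Real.cos τ) := by
  have hlt := supportGap_lt_of_bound hf hM φ h0 h1
  rw [abs_le] at h1
  have : 0 < supportGap f φ τ := by
    rcases lt_or_gt_of_ne h0 with h | h
    · exact supportGap_pos_of_neg hf hpos φ h h1.1
    · exact supportGap_pos_of_pos hf hpos φ h h1.2
  rw [abs_of_pos this]
  exact hlt.le

/-- Each of the two gaps is at most `M (1 - cos τ)`, and their product with the function of `ω`
absorbs the denominator `sin³ τ` at both ends of `(0, π)`. A bounded density on a bounded rectangle
gives absolute convergence over the unbounded exterior. -/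
theorem abs_angleDensity_le (hf : ContDiff ℝ 2 f) (hpos : ∀ x, 0 < f x + deriv (deriv f) x)
    {M : ℝ} (hM : ∀ x, f x + deriv (deriv f) x < M) (φ : ℝ) {τ : ℝ} (hτ : τ ∈ Ioo 0 Real.pi) :
    |angleDensity f (φ, τ)| ≤ M ^ 2 * (11 * Real.pi ^ 3) := by
  have hs := Real.sin_pos_of_mem_Ioo hτ
  have habs : |τ| ≤ Real.pi := by rw [abs_of_pos hτ.1]; exact hτ.2.le
  have h1 := abs_supportGap_le hf hpos hM φ hτ.1.ne' habs
  have h2 := abs_supportGap_le hf hpos hM (φ + τ) (neg_ne_zero.2 hτ.1.ne') (by rwa [abs_neg])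
  rw [Real.cos_neg] at h2
  have h3 := abs_angleIntegrand_pi_sub_mul_le hτ
  have e : |angleDensity f (φ, τ)| = |supportGap f φ τ| * |supportGap f (φ + τ) (-τ)| *
      |angleIntegrand (Real.pi - τ)| / Real.sin τ ^ 3 := by
    rw [angleDensity, tangentLength, abs_mul, abs_mul, abs_div, abs_div, abs_pow, abs_of_pos hs]
    field_simp
  rw [e, div_le_iff₀ (by positivity)]
  have hM0 : 0 ≤ M * (1 - Real.cos τ) := (abs_nonneg _).trans h1
  calc _ ≤ (M * (1 - Real.cos τ)) * (M * (1 - Real.cos τ)) * |angleIntegrand (Real.pi - τ)| := by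
        gcongr
    _ = M ^ 2 * (|angleIntegrand (Real.pi - τ)| * (1 - Real.cos τ) ^ 2) := by ring
    _ ≤ M ^ 2 * (11 * Real.pi ^ 3 * Real.sin τ ^ 3) := by gcongr
    _ = _ := by ring

theorem abs_angleKernel_mul_sq_le (hf : ContDiff ℝ 2 f)
    (hpos : ∀ x, 0 < f x + deriv (deriv f) x) {M : ℝ} (hM : ∀ x, f x + deriv (deriv f) x < M)
    (φ : ℝ) {τ : ℝ} (hτ : τ ∈ Ioo 0 Real.pi) :
    |angleKernel τ * supportGap f φ τ ^ 2| ≤ 32 * M ^ 2 := by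
  have habs : |τ| ≤ Real.pi := by rw [abs_of_pos hτ.1]; exact hτ.2.le
  have h1 := abs_supportGap_le hf hpos hM φ hτ.1.ne' habs
  have h2 := abs_angleKernel_mul_le hτ
  have h3 := one_sub_cos_pos hτ
  have h4 := Real.neg_one_le_cos τ
  rw [abs_mul, abs_pow]
  calc |angleKernel τ| * |supportGap f φ τ| ^ 2
      ≤ |angleKernel τ| * (M * (1 - Real.cos τ)) ^ 2 := by gcongr
    _ = (|angleKernel τ| * (1 - Real.cos τ)) * (M ^ 2 * (1 - Real.cos τ)) := by ring
    _ ≤ 16 * (M ^ 2 * 2) := by gcongr; linarith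
    _ = _ := by ring

theorem continuousOn_angleDensity (hf : ContDiff ℝ 2 f) :
    ContinuousOn (angleDensity f) (Ico 0 (2 * Real.pi) ×ˢ Ioo 0 Real.pi) := by
  have hg := continuous_supportGap hf
  have hg2 : Continuous fun x : ℝ × ℝ => supportGap f (x.1 + x.2) (-x.2) :=
    hg.comp (by fun_prop : Continuous fun x : ℝ × ℝ => (x.1 + x.2, -x.2))
  have hs : ∀ x ∈ Ico 0 (2 * Real.pi) ×ˢ Ioo 0 Real.pi, Real.sin (x : ℝ × ℝ).2 ≠ 0 :=
    fun x hx => (Real.sin_pos_of_mem_Ioo hx.2).ne'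
  unfold angleDensity tangentLength
  refine ((hg.continuousOn.div (by fun_prop) hs).mul (hg2.continuousOn.div (by fun_prop)
    fun x hx => pow_ne_zero 2 (hs x hx))).mul ?_
  unfold angleIntegrand
  fun_prop

theorem measurableSet_tangentDomain :
    MeasurableSet (Ico 0 (2 * Real.pi) ×ˢ Ioo 0 Real.pi : Set (ℝ × ℝ)) :=
  measurableSet_Ico.prod measurableSet_Ioo

theorem volume_tangentDomain_lt_top :
    volume (Ico 0 (2 * Real.pi) ×ˢ Ioo 0 Real.pi : Set (ℝ × ℝ)) < ⊤ := by
  rw [Measure.volume_eq_prod, Measure.prod_prod, Real.volume_Ico, Real.volume_Ioo]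
  exact ENNReal.mul_lt_top ENNReal.ofReal_lt_top ENNReal.ofReal_lt_top

theorem integrableOn_angleDensity (hf : ContDiff ℝ 2 f)
    (hper : Function.Periodic f (2 * Real.pi)) (hpos : ∀ x, 0 < f x + deriv (deriv f) x) :
    IntegrableOn (angleDensity f) (Ico 0 (2 * Real.pi) ×ˢ Ioo 0 Real.pi) := by
  obtain ⟨M, hM⟩ := exists_radius_lt hf hper
  refine IntegrableOn.of_bound volume_tangentDomain_lt_top
    ((continuousOn_angleDensity hf).aestronglyMeasurable measurableSet_tangentDomain)
    (M ^ 2 * (11 * Real.pi ^ 3)) ?_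
  filter_upwards [ae_restrict_mem measurableSet_tangentDomain] with x hx
  exact abs_angleDensity_le hf hpos hM x.1 hx.2

theorem integrableOn_angleKernel_mul_sq (hf : ContDiff ℝ 2 f)
    (hper : Function.Periodic f (2 * Real.pi)) (hpos : ∀ x, 0 < f x + deriv (deriv f) x) :
    IntegrableOn (fun x : ℝ × ℝ => angleKernel x.2 * supportGap f x.1 x.2 ^ 2)
      (Ico 0 (2 * Real.pi) ×ˢ Ioo 0 Real.pi) := by
  obtain ⟨M, hM⟩ := exists_radius_lt hf hper
  refine IntegrableOn.of_bound volume_tangentDomain_lt_top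
    (ContinuousOn.aestronglyMeasurable ?_ measurableSet_tangentDomain) (32 * M ^ 2) ?_
  · exact (continuousOn_angleKernel.comp continuousOn_snd fun x hx => hx.2).mul
      ((continuous_supportGap hf).pow 2).continuousOn
  · filter_upwards [ae_restrict_mem measurableSet_tangentDomain] with x hx
    exact abs_angleKernel_mul_sq_le hf hpos hM x.1 hx.2

/-- Integration by parts: the density is `½ (t²)' g(π - τ)` with `t` the tangent length, and `g'(π -
τ) t²` is `angleKernel` times the squared gap. -/
theorem integral_angleDensity (hf : ContDiff ℝ 2 f)
    (hper : Function.Periodic f (2 * Real.pi)) (hpos : ∀ x, 0 < f x + deriv (deriv f) x) (φ : ℝ) :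
    ∫ τ in Ioo 0 Real.pi, angleDensity f (φ, τ) =
      1 / 2 * ∫ τ in Ioo 0 Real.pi, angleKernel τ * supportGap f φ τ ^ 2 := by
  have hpi := Real.pi_pos
  obtain ⟨M, hM⟩ := exists_radius_lt hf hper
  have hsection : Continuous fun τ : ℝ => (φ, τ) := by fun_prop
  have hgc : Continuous (supportGap f φ) := (continuous_supportGap hf).comp hsection
  have i2 : IntegrableOn (fun τ => angleKernel τ * supportGap f φ τ ^ 2) (Ioo 0 Real.pi) := by
    refine IntegrableOn.of_bound (by simp)
      ((continuousOn_angleKernel.mul (hgc.pow 2).continuousOn).aestronglyMeasurable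
        measurableSet_Ioo) (32 * M ^ 2) ?_
    filter_upwards [ae_restrict_mem measurableSet_Ioo] with τ hτ
    exact abs_angleKernel_mul_sq_le hf hpos hM φ hτ
  have i1 : IntegrableOn (fun τ => angleDensity f (φ, τ)) (Ioo 0 Real.pi) := by
    have hc : ContinuousOn (fun τ => angleDensity f (φ, τ)) (Ioo 0 Real.pi) := by
      have hg2 : Continuous fun τ : ℝ => supportGap f (φ + τ) (-τ) :=
        (continuous_supportGap hf).comp (by fun_prop : Continuous fun τ : ℝ => (φ + τ, -τ))
      have hs : ∀ τ ∈ Ioo 0 Real.pi, Real.sin τ ≠ 0 :=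
        fun τ hτ => (Real.sin_pos_of_mem_Ioo hτ).ne'
      unfold angleDensity tangentLength
      refine ((hgc.continuousOn.div (by fun_prop) hs).mul (hg2.continuousOn.div (by fun_prop)
        fun x hx => pow_ne_zero 2 (hs x hx))).mul ?_
      unfold angleIntegrand
      fun_prop
    refine IntegrableOn.of_bound (by simp)
      (hc.aestronglyMeasurable measurableSet_Ioo) (M ^ 2 * (11 * Real.pi ^ 3)) ?_
    filter_upwards [ae_restrict_mem measurableSet_Ioo] with τ hτ
    exact abs_angleDensity_le hf hpos hM φ hτ
  set F : ℝ → ℝ := fun τ => 1 / 2 * (angleIntegrand (Real.pi - τ) * tangentLength f φ τ ^ 2)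
  have hF : ∀ τ ∈ Ioo 0 Real.pi, HasDerivAt F
      (angleDensity f (φ, τ) - 1 / 2 * (angleKernel τ * supportGap f φ τ ^ 2)) τ := by
    intro τ hτ
    have hs := (Real.sin_pos_of_mem_Ioo hτ).ne'
    refine (((hasDerivAt_angleIntegrand_pi_sub hτ).mul
      ((hasDerivAt_tangentLength hf φ hs).pow 2)).const_mul (1 / 2)).congr_deriv ?_
    simp only [angleDensity, tangentLength, Nat.cast_ofNat, Nat.add_one_sub_one, pow_one,
      Pi.pow_apply]
    field_simp
    ring
  -- The bound by a multiple of `sin τ` makes both boundary terms vanish.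
  have hFb : ∀ τ ∈ Ioo 0 Real.pi, |F τ| ≤ M ^ 2 * (11 * Real.pi ^ 3) * Real.sin τ := by
    intro τ hτ
    have hs := Real.sin_pos_of_mem_Ioo hτ
    have habs : |τ| ≤ Real.pi := by rw [abs_of_pos hτ.1]; exact hτ.2.le
    have h1 := abs_supportGap_le hf hpos hM φ hτ.1.ne' habs
    have h3 := abs_angleIntegrand_pi_sub_mul_le hτ
    have e : |F τ| = 1 / 2 * (|angleIntegrand (Real.pi - τ)| * |supportGap f φ τ| ^ 2) /
        Real.sin τ ^ 2 := by
      simp only [F, tangentLength]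
      rw [abs_mul, abs_of_pos (by norm_num : (0 : ℝ) < 1 / 2), abs_mul, abs_pow, abs_div,
        abs_of_pos hs]
      field_simp
    rw [e, div_le_iff₀ (by positivity)]
    calc _ ≤ 1 * (|angleIntegrand (Real.pi - τ)| * (M * (1 - Real.cos τ)) ^ 2) := by
          gcongr
          norm_num
      _ = M ^ 2 * (|angleIntegrand (Real.pi - τ)| * (1 - Real.cos τ) ^ 2) := by ring
      _ ≤ M ^ 2 * (11 * Real.pi ^ 3 * Real.sin τ ^ 3) := by gcongr
      _ = _ := by ring
  have hsin : Continuous fun τ => M ^ 2 * (11 * Real.pi ^ 3) * Real.sin τ := by fun_prop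
  have hl : Tendsto F (𝓝[>] 0) (𝓝 0) := by
    refine squeeze_zero_norm' (a := fun τ => M ^ 2 * (11 * Real.pi ^ 3) * Real.sin τ) ?_ ?_
    · filter_upwards [Ioo_mem_nhdsGT hpi] with τ hτ using hFb τ hτ
    · have := (hsin.tendsto 0).mono_left (nhdsWithin_le_nhds (s := Ioi 0))
      simpa using this
  have hr : Tendsto F (𝓝[<] Real.pi) (𝓝 0) := by
    refine squeeze_zero_norm' (a := fun τ => M ^ 2 * (11 * Real.pi ^ 3) * Real.sin τ) ?_ ?_
    · filter_upwards [Ioo_mem_nhdsLT hpi] with τ hτ using hFb τ hτ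
    · have := (hsin.tendsto Real.pi).mono_left (nhdsWithin_le_nhds (s := Iio Real.pi))
      simpa using this
  have hint := i1.sub (i2.const_mul (1 / 2))
  have key := intervalIntegral.integral_eq_sub_of_hasDerivAt_of_tendsto hpi hF
    ((intervalIntegrable_iff_integrableOn_Ioo_of_le hpi.le).2 hint) hl hr
  rw [intervalIntegral.integral_of_le hpi.le, integral_Ioc_eq_integral_Ioo, sub_self,
    integral_sub i1 (i2.const_mul _), integral_const_mul] at key
  linarith

end

theorem angle_integral {K : Set Plane} (hK : IsStrictlyConvexC2 K) :
    IntegrableOn (fun P => angleIntegrand (visualAngle K P)) Kᶜ ∧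
      ∫ P in Kᶜ, angleIntegrand (visualAngle K P) =
        1 / 2 * ∫ τ in Ioo 0 Real.pi, angleKernel τ *
          ∫ φ in (0 : ℝ)..(2 * Real.pi), supportGap (supportFun K) φ τ ^ 2 := by
  have hf := hK.contDiff
  have hper := supportFun_periodic K
  set p := supportFun K with hp
  choose! a ha using fun x (hx : x ∈ (Ico 0 (2 * Real.pi) ×ˢ Ioo 0 Real.pi : Set (ℝ × ℝ))) =>
    hasFDerivAt_tangentLength hf (Real.sin_pos_of_mem_Ioo hx.2).ne'
  have hinj : InjOn (fun x : ℝ × ℝ => tangentPoint p x.1 (tangentLength p x.1 x.2))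
      (Ico 0 (2 * Real.pi) ×ˢ Ioo 0 Real.pi) := tangentMeet_injOn hf hper hK.radius_pos
  have himage : (fun x : ℝ × ℝ => tangentPoint p x.1 (tangentLength p x.1 x.2)) ''
      (Ico 0 (2 * Real.pi) ×ˢ Ioo 0 Real.pi) = Kᶜ := image_tangentMeet hK
  have heq : EqOn (fun x : ℝ × ℝ => |tangentLength p x.1 x.2 *
      (supportGap p (x.1 + x.2) (-x.2) / Real.sin x.2 ^ 2)| *
        angleIntegrand (visualAngle K (tangentPoint p x.1 (tangentLength p x.1 x.2))))
      (angleDensity p) (Ico 0 (2 * Real.pi) ×ˢ Ioo 0 Real.pi) := by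
    rintro ⟨φ, τ⟩ ⟨hφ, hτ⟩
    have h1 := visualAngle_tangentMeet hK φ hτ
    rw [tangentMeet] at h1
    simp only at h1 ⊢
    rw [h1, abs_of_pos, angleDensity]
    refine mul_pos (tangentLength_pos hf hK.radius_pos φ hτ) (div_pos ?_
      (pow_pos (Real.sin_pos_of_mem_Ioo hτ) 2))
    exact supportGap_pos_of_neg hf hK.radius_pos _ (by linarith [hτ.1]) (by linarith [hτ.2])
  constructor
  · rw [← himage, integrableOn_image_tangentPoint_iff hf measurableSet_tangentDomain ha hinj,
      integrableOn_congr_fun heq measurableSet_tangentDomain]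
    exact integrableOn_angleDensity hf hper hK.radius_pos
  · rw [← himage, integral_image_tangentPoint hf measurableSet_tangentDomain ha hinj,
      setIntegral_congr_fun measurableSet_tangentDomain heq, Measure.volume_eq_prod,
      setIntegral_prod _ (integrableOn_angleDensity hf hper hK.radius_pos)]
    simp_rw [integral_angleDensity hf hper hK.radius_pos]
    rw [integral_const_mul]
    have hint := integrableOn_angleKernel_mul_sq hf hper hK.radius_pos
    rw [IntegrableOn, Measure.volume_eq_prod, ← Measure.prod_restrict] at hint
    -- With `φ` as the inner variable, Parseval applies for each fixed `τ`.
    rw [integral_integral_swap hint]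
    simp_rw [integral_const_mul]
    simp_rw [intervalIntegral.integral_of_le Real.two_pi_pos.le, integral_Ico_eq_integral_Ioc]

/-! ### Fourier coefficients of periodic functions -/

/-- The `n`-th complex Fourier coefficient of a `2π`-periodic real function. -/
def coeff (f : ℝ → ℝ) (n : ℤ) : ℂ :=
  1 / (2 * Real.pi) * ∫ x in (0 : ℝ)..(2 * Real.pi), Complex.exp (-(n * x * Complex.I)) * f x

theorem coeff_eq_fourierCoeffOn (f : ℝ → ℝ) (n : ℤ) :
    coeff f n = fourierCoeffOn Real.two_pi_pos (fun x => (f x : ℂ)) n := by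
  rw [fourierCoeffOn_eq_integral, coeff, Complex.real_smul]
  congr 1
  · push_cast
    rw [sub_zero]
  · refine intervalIntegral.integral_congr fun x _ => ?_
    simp only [smul_eq_mul]
    rw [fourier_coe_apply]
    congr 2
    push_cast
    have : (Real.pi : ℂ) ≠ 0 := by exact_mod_cast Real.pi_ne_zero
    field_simp
    ring

theorem hasSum_norm_coeff_sq {f : ℝ → ℝ} (hf : Continuous f) :
    HasSum (fun n => ‖coeff f n‖ ^ 2)
      ((2 * Real.pi)⁻¹ * ∫ x in (0 : ℝ)..(2 * Real.pi), f x ^ 2) := by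
  have hc : Continuous fun x => (f x : ℂ) := by fun_prop
  have hL : MemLp (fun x => (f x : ℂ)) 2 (volume.restrict (Ioc 0 (2 * Real.pi))) :=
    (memLp_two_iff_integrable_sq_norm hc.aestronglyMeasurable).2
      ((by fun_prop : Continuous fun x => ‖(f x : ℂ)‖ ^ 2).integrableOn_Ioc)
  have := hasSum_sq_fourierCoeffOn Real.two_pi_pos hL
  simpa [coeff_eq_fourierCoeffOn] using this

theorem continuous_exp_mul {f : ℝ → ℝ} (hf : Continuous f) (n : ℤ) :
    Continuous fun x : ℝ => Complex.exp (-(n * x * Complex.I)) * f x := by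
  fun_prop

theorem coeff_add {f g : ℝ → ℝ} (hf : Continuous f) (hg : Continuous g) (n : ℤ) :
    coeff (fun x => f x + g x) n = coeff f n + coeff g n := by
  simp only [coeff, ← mul_add]
  rw [← intervalIntegral.integral_add ((continuous_exp_mul hf n).intervalIntegrable _ _)
    ((continuous_exp_mul hg n).intervalIntegrable _ _)]
  simp [mul_add]

theorem coeff_mul_const (f : ℝ → ℝ) (c : ℝ) (n : ℤ) :
    coeff (fun x => f x * c) n = coeff f n * c := by
  simp only [coeff, Complex.ofReal_mul, ← mul_assoc]
  rw [intervalIntegral.integral_mul_const, mul_assoc]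

theorem coeff_sub {f g : ℝ → ℝ} (hf : Continuous f) (hg : Continuous g) (n : ℤ) :
    coeff (fun x => f x - g x) n = coeff f n - coeff g n := by
  have h := coeff_add hf (g := fun x => g x * (-1)) (by fun_prop) n
  rw [coeff_mul_const] at h
  simpa [sub_eq_add_neg] using h

theorem exp_int_mul_two_pi (n : ℤ) : Complex.exp (-(n * (2 * Real.pi : ℝ) * Complex.I)) = 1 := by
  rw [Complex.exp_eq_one_iff]
  exact ⟨-n, by push_cast; ring⟩

theorem coeff_deriv {f f' : ℝ → ℝ} (hf : ∀ x, HasDerivAt f (f' x) x) (hf' : Continuous f')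
    (hper : Function.Periodic f (2 * Real.pi)) (n : ℤ) :
    coeff f' n = n * Complex.I * coeff f n := by
  have hu : ∀ x : ℝ, HasDerivAt (fun x : ℝ => Complex.exp (-(n * x * Complex.I)))
      (-(n * Complex.I) * Complex.exp (-(n * x * Complex.I))) x := fun x => by
    have h1 : HasDerivAt (fun x : ℝ => -(n * (x : ℂ) * Complex.I)) (-(n * Complex.I)) x := by
      simpa using (((hasDerivAt_id x).ofReal_comp.const_mul (n : ℂ)).mul_const Complex.I).fun_neg
    refine h1.cexp.congr_deriv (mul_comm _ _)
  have key := intervalIntegral.integral_mul_deriv_eq_deriv_mul (a := 0) (b := 2 * Real.pi)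
    (fun x _ => hu x) (fun x _ => (hf x).ofReal_comp)
    ((by fun_prop : Continuous _).intervalIntegrable _ _)
    ((by fun_prop : Continuous _).intervalIntegrable _ _)
  have h0 : f (2 * Real.pi) = f 0 := by simpa using hper 0
  rw [exp_int_mul_two_pi, h0] at key
  simp only [coeff]
  rw [key]
  rw [show ∀ J : ℂ, 1 * (f 0 : ℂ) - Complex.exp (-(n * (0 : ℝ) * Complex.I)) * f 0 - J = -J by simp,
    ← intervalIntegral.integral_neg]
  simp only [neg_mul, neg_neg, mul_assoc, intervalIntegral.integral_const_mul]
  ring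

theorem coeff_comp_add {f : ℝ → ℝ} (hper : Function.Periodic f (2 * Real.pi)) (τ : ℝ) (n : ℤ) :
    coeff (fun x => f (x + τ)) n = Complex.exp (n * τ * Complex.I) * coeff f n := by
  set G : ℝ → ℂ := fun x => Complex.exp (-(n * x * Complex.I)) * f x with hG
  have hGper : Function.Periodic G (2 * Real.pi) := fun x => by
    have := exp_int_mul_two_pi n
    simp only [hG]
    rw [hper]
    congr 1
    rw [← mul_one (Complex.exp (-(n * x * Complex.I))), ← this, ← Complex.exp_add]
    congr 1
    push_cast
    ring
  have e : ∀ x : ℝ, Complex.exp (-(n * x * Complex.I)) * (f (x + τ) : ℂ) =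
      Complex.exp (n * τ * Complex.I) * G (x + τ) := fun x => by
    simp only [hG]
    rw [← mul_assoc, ← Complex.exp_add]
    congr 2
    push_cast
    ring
  simp only [coeff, e]
  rw [intervalIntegral.integral_const_mul, intervalIntegral.integral_comp_add_right (fun x => G x),
    zero_add, add_comm (2 * Real.pi) τ, hGper.intervalIntegral_add_eq τ 0, zero_add]
  ring

theorem coeff_zero (f : ℝ → ℝ) :
    coeff f 0 = ((1 / (2 * Real.pi) * ∫ x in (0 : ℝ)..(2 * Real.pi), f x : ℝ) : ℂ) := by
  simp only [coeff, Int.cast_zero, zero_mul, neg_zero, Complex.exp_zero, one_mul]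
  rw [intervalIntegral.integral_ofReal]
  push_cast
  ring

/-- A periodic solution of `f'' = -k² f` has no Fourier coefficients but those of index `±k`. -/
theorem coeff_eq_zero_of_deriv_deriv {f f' : ℝ → ℝ} {k : ℝ} (hf : ∀ x, HasDerivAt f (f' x) x)
    (hf' : ∀ x, HasDerivAt f' (-k ^ 2 * f x) x) (hper : Function.Periodic f (2 * Real.pi))
    (hper' : Function.Periodic f' (2 * Real.pi)) {n : ℤ} (hn : (n : ℝ) ^ 2 ≠ k ^ 2) :
    coeff f n = 0 := by
  have c0 : Continuous f := continuous_iff_continuousAt.2 fun x => (hf x).continuousAt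
  have c1 : Continuous f' := continuous_iff_continuousAt.2 fun x => (hf' x).continuousAt
  have h1 := coeff_deriv hf c1 hper n
  have h2 := coeff_deriv hf' (by fun_prop) hper' n
  have h3 := coeff_mul_const f (-k ^ 2) n
  simp_rw [mul_comm _ (-k ^ 2)] at h3
  rw [h3, h1] at h2
  have h4 : (((n : ℝ) ^ 2 - k ^ 2 : ℝ) : ℂ) * coeff f n = 0 := by
    push_cast at h2 ⊢
    linear_combination h2 + n ^ 2 * coeff f n * Complex.I_sq
  rcases mul_eq_zero.1 h4 with h | h
  · exact absurd (sub_eq_zero.1 (Complex.ofReal_eq_zero.1 h)) hn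
  · exact h

theorem coeff_const {c : ℝ} {n : ℤ} (hn : n ≠ 0) : coeff (fun _ => c) n = 0 := by
  refine coeff_eq_zero_of_deriv_deriv (f' := fun _ => 0) (k := 0) (fun x => hasDerivAt_const x c)
    (fun x => ?_) (fun _ => rfl) (fun _ => rfl) ?_
  · simpa using hasDerivAt_const x (0 : ℝ)
  · simpa using hn

/-- For even `n` the shift by `π` leaves the coefficient unchanged, so twice the coefficient is that
of a constant. -/
theorem coeff_eq_zero_of_constantWidth {f : ℝ → ℝ} {w : ℝ} (hf : Continuous f)
    (hper : Function.Periodic f (2 * Real.pi)) (hw : ∀ x, f x + f (x + Real.pi) = w) {n : ℤ}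
    (hn : Even n) (hn0 : n ≠ 0) : coeff f n = 0 := by
  have h := coeff_add hf (g := fun x => f (x + Real.pi)) (by fun_prop) n
  simp_rw [hw] at h
  rw [coeff_const hn0, coeff_comp_add hper] at h
  obtain ⟨m, rfl⟩ := hn
  have : Complex.exp (((m + m : ℤ) : ℂ) * Real.pi * Complex.I) = 1 := by
    rw [Complex.exp_eq_one_iff]
    exact ⟨m, by push_cast; ring⟩
  rw [this] at h
  linear_combination -1 / 2 * h

/-! ### Fourier expansion of the support gap -/

/-- The square modulus of the multiplier of the map `f ↦ supportGap f · τ`. -/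
def gapMultiplier (n : ℤ) (τ : ℝ) : ℝ :=
  (Real.cos (n * τ) - Real.cos τ) ^ 2 + (Real.sin (n * τ) - n * Real.sin τ) ^ 2

/-- The gap acts on `e^{inφ}` as multiplication by `e^{inτ} - cos τ - i n sin τ`. -/
theorem norm_coeff_supportGap_sq {f : ℝ → ℝ} (hf : ContDiff ℝ 2 f)
    (hper : Function.Periodic f (2 * Real.pi)) (τ : ℝ) (n : ℤ) :
    ‖coeff (fun φ => supportGap f φ τ) n‖ ^ 2 = gapMultiplier n τ * ‖coeff f n‖ ^ 2 := by
  have c0 := hf.continuous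
  have c1 := continuous_deriv_of_contDiff hf
  have h : coeff (fun φ => supportGap f φ τ) n =
      ((Real.cos (n * τ) - Real.cos τ : ℝ) + (Real.sin (n * τ) - n * Real.sin τ : ℝ) * Complex.I) *
        coeff f n := by
    unfold supportGap
    rw [coeff_sub (by fun_prop) (by fun_prop), coeff_sub (by fun_prop) (by fun_prop),
      coeff_comp_add hper, coeff_mul_const, coeff_mul_const,
      coeff_deriv (hasDerivAt_of_contDiff hf) c1 hper, Complex.exp_mul_I]
    push_cast
    ring
  rw [h, norm_mul, mul_pow, ← Complex.normSq_eq_norm_sq (_ + _), Complex.normSq_add_mul_I]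
  rfl

theorem hasSum_supportGap_sq {f : ℝ → ℝ} (hf : ContDiff ℝ 2 f)
    (hper : Function.Periodic f (2 * Real.pi)) (τ : ℝ) :
    HasSum (fun n => gapMultiplier n τ * ‖coeff f n‖ ^ 2)
      ((2 * Real.pi)⁻¹ * ∫ φ in (0 : ℝ)..(2 * Real.pi), supportGap f φ τ ^ 2) := by
  have hc : Continuous fun φ => supportGap f φ τ :=
    (continuous_supportGap hf).comp (by fun_prop : Continuous fun φ : ℝ => (φ, τ))
  have := hasSum_norm_coeff_sq hc
  simpa only [norm_coeff_supportGap_sq hf hper] using this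

theorem hasSum_sq_deriv {f : ℝ → ℝ} (hf : ContDiff ℝ 2 f)
    (hper : Function.Periodic f (2 * Real.pi)) :
    HasSum (fun n : ℤ => (n : ℝ) ^ 2 * ‖coeff f n‖ ^ 2)
      ((2 * Real.pi)⁻¹ * ∫ φ in (0 : ℝ)..(2 * Real.pi), deriv f φ ^ 2) := by
  have := hasSum_norm_coeff_sq (continuous_deriv_of_contDiff hf)
  refine this.congr_fun fun n => ?_
  rw [coeff_deriv (hasDerivAt_of_contDiff hf) (continuous_deriv_of_contDiff hf) hper]
  simp [mul_pow]

theorem hasSum_sq_deriv_deriv {f : ℝ → ℝ} (hf : ContDiff ℝ 2 f)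
    (hper : Function.Periodic f (2 * Real.pi)) :
    HasSum (fun n : ℤ => (n : ℝ) ^ 4 * ‖coeff f n‖ ^ 2)
      ((2 * Real.pi)⁻¹ * ∫ φ in (0 : ℝ)..(2 * Real.pi), deriv (deriv f) φ ^ 2) := by
  have := hasSum_norm_coeff_sq (continuous_deriv_deriv_of_contDiff hf)
  refine this.congr_fun fun n => ?_
  rw [coeff_deriv (hasDerivAt_deriv_of_contDiff hf) (continuous_deriv_deriv_of_contDiff hf)
    (periodic_deriv hper), coeff_deriv (hasDerivAt_of_contDiff hf)
    (continuous_deriv_of_contDiff hf) hper]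
  simp [mul_pow]
  ring

/-! ### Integrals of the multipliers -/

theorem integral_cos_int_mul (k : ℤ) :
    ∫ τ in (0 : ℝ)..Real.pi, Real.cos (k * τ) = if k = 0 then Real.pi else 0 := by
  split_ifs with h
  · simp [h]
  · rw [intervalIntegral.integral_comp_mul_left (fun x => Real.cos x) (by exact_mod_cast h),
      integral_cos]
    simp [Real.sin_int_mul_pi]

theorem integral_cos_mul_cos (j k : ℤ) :
    ∫ τ in (0 : ℝ)..Real.pi, Real.cos (j * τ) * Real.cos (k * τ) =
      1 / 2 * ((if j - k = 0 then Real.pi else 0) + if j + k = 0 then Real.pi else 0) := by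
  rw [← integral_cos_int_mul, ← integral_cos_int_mul, ← intervalIntegral.integral_add,
    ← intervalIntegral.integral_const_mul]
  · refine intervalIntegral.integral_congr fun τ _ => ?_
    push_cast
    rw [sub_mul, add_mul, Real.cos_sub, Real.cos_add]
    ring
  all_goals exact (by fun_prop : Continuous _).intervalIntegrable _ _

/-- The shape is that of `gapMultiplier` after expansion. It is used with `j = 1, 2`, the two
frequencies of the kernel besides its singular part. -/
theorem integral_cos_mul_combination (j k l : ℤ) (a b c d : ℝ) :
    ∫ τ in (0 : ℝ)..Real.pi, Real.cos (j * τ) *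
        (a + b * Real.cos (2 * τ) + c * Real.cos (k * τ) + d * Real.cos (l * τ)) =
      a * (∫ τ in (0 : ℝ)..Real.pi, Real.cos (j * τ) * Real.cos ((0 : ℤ) * τ)) +
      b * (∫ τ in (0 : ℝ)..Real.pi, Real.cos (j * τ) * Real.cos ((2 : ℤ) * τ)) +
      c * (∫ τ in (0 : ℝ)..Real.pi, Real.cos (j * τ) * Real.cos (k * τ)) +
      d * (∫ τ in (0 : ℝ)..Real.pi, Real.cos (j * τ) * Real.cos (l * τ)) := by
  simp only [← intervalIntegral.integral_const_mul]
  rw [← intervalIntegral.integral_add, ← intervalIntegral.integral_add,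
    ← intervalIntegral.integral_add]
  · refine intervalIntegral.integral_congr fun τ _ => ?_
    simp
    ring
  all_goals exact (by fun_prop : Continuous _).intervalIntegrable _ _

/-- The Fejér kernel, up to normalization. -/
def fejer (m : ℕ) (τ : ℝ) : ℝ := (1 - Real.cos (m * τ)) / (1 - Real.cos τ)

/-- In the second difference the numerator is `2 (1 - cos τ) cos((m+1)τ)`, so the denominator
cancels. As that cosine has integral `0` over `(0, π)`, the integral of `fejer m` is linear in `m`.
-/
theorem fejer_add_two (m : ℕ) {τ : ℝ} (hτ : τ ∈ Ioo 0 Real.pi) :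
    fejer (m + 2) τ = 2 * fejer (m + 1) τ - fejer m τ + 2 * Real.cos (((m + 1 : ℕ) : ℤ) * τ) := by
  have h := (one_sub_cos_pos hτ).ne'
  have hc : Real.cos (((m : ℝ) + 2) * τ) =
      2 * Real.cos τ * Real.cos ((m + 1) * τ) - Real.cos (m * τ) := by
    rw [show ((m : ℝ) + 2) * τ = (m + 1) * τ + τ by ring,
      show (m : ℝ) * τ = (m + 1) * τ - τ by ring, Real.cos_add, Real.cos_sub]
    ring
  simp only [fejer]
  push_cast
  rw [hc]
  field_simp
  ring

theorem integrableOn_fejer_and_integral (m : ℕ) :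
    IntegrableOn (fejer m) (Ioo 0 Real.pi) ∧ ∫ τ in Ioo 0 Real.pi, fejer m τ = m * Real.pi := by
  induction m using Nat.twoStepInduction with
  | zero =>
    have h : fejer 0 = fun _ => 0 := funext fun τ => by simp [fejer]
    simp [h]
  | one =>
    have h : EqOn (fejer 1) (fun _ => 1) (Ioo 0 Real.pi) := fun τ hτ => by
      have := (one_sub_cos_pos hτ).ne'
      simp [fejer, this]
    rw [integrableOn_congr_fun h measurableSet_Ioo, setIntegral_congr_fun measurableSet_Ioo h]
    simp [Real.pi_pos.le]
  | more m ih1 ih2 =>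
    have h : EqOn (fejer (m + 2)) (fun τ => 2 * fejer (m + 1) τ - fejer m τ +
        2 * Real.cos (((m + 1 : ℕ) : ℤ) * τ)) (Ioo 0 Real.pi) := fun τ hτ => fejer_add_two m hτ
    have hc : IntegrableOn (fun τ => 2 * Real.cos (((m + 1 : ℕ) : ℤ) * τ)) (Ioo 0 Real.pi) :=
      (by fun_prop : Continuous _).integrableOn_Icc.mono_set Ioo_subset_Icc_self
    have hi : IntegrableOn (fun τ => 2 * fejer (m + 1) τ - fejer m τ) (Ioo 0 Real.pi) :=
      (ih2.1.const_mul 2).sub ih1.1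
    rw [integrableOn_congr_fun h measurableSet_Ioo, setIntegral_congr_fun measurableSet_Ioo h]
    refine ⟨hi.add hc, ?_⟩
    rw [integral_add hi hc, integral_sub (ih2.1.const_mul 2) ih1.1, integral_const_mul,
      integral_const_mul, ih1.2, ih2.2, ← integral_Ioc_eq_integral_Ioo,
      ← intervalIntegral.integral_of_le Real.pi_pos.le, integral_cos_int_mul,
      if_neg (by positivity)]
    push_cast
    ring

theorem gapMultiplier_neg (n : ℤ) (τ : ℝ) : gapMultiplier (-n) τ = gapMultiplier n τ := by
  simp only [gapMultiplier, Int.cast_neg, neg_mul, Real.cos_neg, Real.sin_neg]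
  ring

/-- With `n = m + 1` this is `(n²-1) sin² τ + (n+1)(1 - cos((n-1)τ)) - (n-1)(1 - cos((n+1)τ))`, and
each term becomes integrable after division by `1 - cos τ`. -/
theorem gapMultiplier_succ (m : ℕ) (τ : ℝ) : gapMultiplier (m + 1 : ℕ) τ =
    ((m : ℝ) ^ 2 + 2 * m) * Real.sin τ ^ 2 + (m + 2) * (1 - Real.cos (m * τ)) -
      m * (1 - Real.cos ((m + 2 : ℕ) * τ)) := by
  simp only [gapMultiplier]
  push_cast
  have h1 : (m : ℝ) * τ = (m + 1) * τ - τ := by ring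
  have h2 : ((m : ℝ) + 2) * τ = (m + 1) * τ + τ := by ring
  rw [h1, h2, Real.cos_add, Real.cos_sub]
  linear_combination Real.sin_sq_add_cos_sq ((m + 1) * τ) + Real.sin_sq_add_cos_sq τ

theorem angleKernel_mul_gapMultiplier_succ (m : ℕ) {τ : ℝ} (hτ : τ ∈ Ioo 0 Real.pi) :
    angleKernel τ * gapMultiplier (m + 1 : ℕ) τ =
      2 * (m + 2) * fejer m τ - 2 * m * fejer (m + 2) τ +
        (2 * ((m : ℝ) ^ 2 + 2 * m) * (1 + Real.cos ((1 : ℤ) * τ)) +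
        (3 * (Real.cos ((1 : ℤ) * τ) * (((m : ℝ) ^ 2 + 2 * m) / 2 + 2 +
            -(((m : ℝ) ^ 2 + 2 * m) / 2) * Real.cos (2 * τ) +
            -(m + 2) * Real.cos ((m : ℤ) * τ) + m * Real.cos ((m + 2 : ℕ) * τ))) +
          4 * (Real.cos ((2 : ℤ) * τ) * (((m : ℝ) ^ 2 + 2 * m) / 2 + 2 +
            -(((m : ℝ) ^ 2 + 2 * m) / 2) * Real.cos (2 * τ) +
            -(m + 2) * Real.cos ((m : ℤ) * τ) + m * Real.cos ((m + 2 : ℕ) * τ))))) := by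
  have h := (one_sub_cos_pos hτ).ne'
  rw [gapMultiplier_succ, angleKernel, fejer, fejer, Real.sin_sq]
  simp only [Int.cast_one, one_mul, Int.cast_ofNat, Int.cast_natCast, Real.cos_two_mul]
  generalize Real.cos ((m : ℝ) * τ) = x
  generalize Real.cos (((m + 2 : ℕ) : ℝ) * τ) = y
  field_simp
  ring

/-- Put `n = m + 1`. The two Fejér integrals cancel, `sin² τ / (1 - cos τ)` yields `2π(n²-1)`, and
`4 cos 2τ` takes away `π(n²-1)`. Since `m` is even, `3 cos τ` is orthogonal to everything. For `n =
3` the term `cos(mτ)` resonates with `4 cos 2τ` and removes the remaining `8π`. -/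
theorem integral_angleKernel_mul_succ {m : ℕ} (hm : Even m) :
    ∫ τ in Ioo 0 Real.pi, angleKernel τ * gapMultiplier (m + 1 : ℕ) τ =
      Real.pi * if 4 ≤ m then ((m + 1 : ℝ) ^ 2 - 1) else 0 := by
  have hpi := Real.pi_pos
  obtain ⟨i1, v1⟩ := integrableOn_fejer_and_integral m
  obtain ⟨i2, v2⟩ := integrableOn_fejer_and_integral (m + 2)
  set a : ℝ := ((m : ℝ) ^ 2 + 2 * m) / 2 with ha
  set T : ℝ → ℝ := fun τ => a + 2 + -a * Real.cos (2 * τ) + -(m + 2) * Real.cos ((m : ℤ) * τ) +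
    m * Real.cos ((m + 2 : ℕ) * τ) with hT
  have i3 : IntegrableOn (fun τ => 2 * ((m : ℝ) ^ 2 + 2 * m) * (1 + Real.cos ((1 : ℤ) * τ)) +
      (3 * (Real.cos ((1 : ℤ) * τ) * T τ) + 4 * (Real.cos ((2 : ℤ) * τ) * T τ)))
      (Ioo 0 Real.pi) :=
    (by fun_prop : Continuous _).integrableOn_Icc.mono_set Ioo_subset_Icc_self
  have hI : ∀ j : ℤ, ∫ τ in (0 : ℝ)..Real.pi, Real.cos (j * τ) * T τ = _ := fun j =>
    integral_cos_mul_combination j m ((m + 2 : ℕ) : ℤ) (a + 2) (-a) (-(m + 2)) m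
  have i12 : IntegrableOn (fun τ => 2 * (m + 2) * fejer m τ - 2 * m * fejer (m + 2) τ)
      (Ioo 0 Real.pi) := (i1.const_mul _).sub (i2.const_mul _)
  have heq : EqOn (fun τ => angleKernel τ * gapMultiplier (m + 1 : ℕ) τ)
      (fun τ => 2 * (m + 2) * fejer m τ - 2 * m * fejer (m + 2) τ +
        (2 * ((m : ℝ) ^ 2 + 2 * m) * (1 + Real.cos ((1 : ℤ) * τ)) +
        (3 * (Real.cos ((1 : ℤ) * τ) * T τ) + 4 * (Real.cos ((2 : ℤ) * τ) * T τ))))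
      (Ioo 0 Real.pi) := fun τ hτ => angleKernel_mul_gapMultiplier_succ m hτ
  rw [setIntegral_congr_fun measurableSet_Ioo heq, integral_add i12 i3,
    integral_sub (i1.const_mul _) (i2.const_mul _), integral_const_mul, integral_const_mul, v1, v2,
    ← integral_Ioc_eq_integral_Ioo, ← intervalIntegral.integral_of_le hpi.le,
    intervalIntegral.integral_add, intervalIntegral.integral_add,
    intervalIntegral.integral_const_mul, intervalIntegral.integral_const_mul,
    intervalIntegral.integral_const_mul, intervalIntegral.integral_add, integral_cos_int_mul,
    hI, hI]
  · simp only [integral_cos_mul_cos]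
    obtain ⟨k, rfl⟩ := hm
    -- The frequency `2` equals `m` or `m + 2` only for `m = 2` and `m = 0`; all other cases are
    -- nonresonant.
    rcases Nat.lt_or_ge k 2 with hk | hk
    · interval_cases k
      · norm_num [ha]
      · norm_num [ha]
        ring
    · have e1 : ((1 : ℤ) - ((k + k : ℕ) : ℤ) = 0) = False := by simp; omega
      have e2 : ((1 : ℤ) + ((k + k : ℕ) : ℤ) = 0) = False := by simp; omega
      have e3 : ((1 : ℤ) - ((k + k + 2 : ℕ) : ℤ) = 0) = False := by simp; omega
      have e4 : ((1 : ℤ) + ((k + k + 2 : ℕ) : ℤ) = 0) = False := by simp; omega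
      have e5 : ((2 : ℤ) - ((k + k : ℕ) : ℤ) = 0) = False := by simp; omega
      have e6 : ((2 : ℤ) + ((k + k : ℕ) : ℤ) = 0) = False := by simp; omega
      have e7 : ((2 : ℤ) - ((k + k + 2 : ℕ) : ℤ) = 0) = False := by simp; omega
      have e8 : ((2 : ℤ) + ((k + k + 2 : ℕ) : ℤ) = 0) = False := by simp; omega
      rw [if_pos (by omega : 4 ≤ k + k)]
      simp only [e1, e2, e3, e4, e5, e6, e7, e8, if_false]
      norm_num [ha]
      ring
  all_goals exact (by fun_prop : Continuous _).intervalIntegrable _ _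

/-- Here the multiplier is `(1 - cos τ)²`, and the three parts of the kernel contribute `2π`, `-3π`
and `π`. The term `3 cos τ` of the kernel serves only this case. -/
theorem integral_angleKernel_mul_zero :
    ∫ τ in Ioo 0 Real.pi, angleKernel τ * gapMultiplier 0 τ = 0 := by
  have h : EqOn (fun τ => angleKernel τ * gapMultiplier 0 τ) (fun τ =>
      2 * (1 - Real.cos ((1 : ℤ) * τ)) +
      (3 * (Real.cos ((1 : ℤ) * τ) * (3 / 2 + 1 / 2 * Real.cos (2 * τ) +
        -2 * Real.cos ((1 : ℤ) * τ) + 0 * Real.cos ((0 : ℤ) * τ))) +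
       4 * (Real.cos ((2 : ℤ) * τ) * (3 / 2 + 1 / 2 * Real.cos (2 * τ) +
        -2 * Real.cos ((1 : ℤ) * τ) + 0 * Real.cos ((0 : ℤ) * τ))))) (Ioo 0 Real.pi) := by
    intro τ hτ
    have h := (one_sub_cos_pos hτ).ne'
    simp only [angleKernel, gapMultiplier, Int.cast_zero, Int.cast_one, zero_mul, Real.cos_zero,
      Real.sin_zero, sub_self, one_mul, Int.cast_ofNat, Real.cos_two_mul]
    field_simp
    ring
  rw [setIntegral_congr_fun measurableSet_Ioo h, ← integral_Ioc_eq_integral_Ioo,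
    ← intervalIntegral.integral_of_le Real.pi_pos.le,
    intervalIntegral.integral_add, intervalIntegral.integral_add,
    intervalIntegral.integral_const_mul, intervalIntegral.integral_const_mul,
    intervalIntegral.integral_const_mul, intervalIntegral.integral_sub, integral_cos_int_mul,
    integral_cos_mul_combination, integral_cos_mul_combination]
  · simp only [integral_cos_mul_cos]
    norm_num
    ring
  all_goals exact (by fun_prop : Continuous _).intervalIntegrable _ _

theorem integral_angleKernel_mul_gapMultiplier {n : ℤ} (hn : n = 0 ∨ Odd n) :
    ∫ τ in Ioo 0 Real.pi, angleKernel τ * gapMultiplier n τ =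
      Real.pi * if 5 ≤ |n| then ((n : ℝ) ^ 2 - 1) else 0 := by
  have hsymm : ∀ τ, gapMultiplier n τ = gapMultiplier (n.natAbs : ℤ) τ := fun τ => by
    rcases Int.natAbs_eq n with h | h
    · rw [← h]
    · nth_rw 1 [h]
      rw [gapMultiplier_neg]
  rcases hn with rfl | hn
  · rw [integral_angleKernel_mul_zero]
    simp
  · obtain ⟨m, hm⟩ : ∃ m, n.natAbs = m + 1 := ⟨n.natAbs - 1, by have := hn.natAbs.pos; omega⟩
    have heven : Even m := by
      have := hn.natAbs
      rw [hm, Nat.odd_add_one, Nat.not_odd_iff_even] at this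
      exact this
    simp_rw [hsymm, hm]
    rw [integral_angleKernel_mul_succ heven]
    have habs : |n| = (m : ℤ) + 1 := by rw [Int.abs_eq_natAbs, hm]; push_cast; rfl
    have hsq : (n : ℝ) ^ 2 = ((m : ℝ) + 1) ^ 2 := by
      rw [← sq_abs]
      have : |(n : ℝ)| = (m : ℝ) + 1 := by exact_mod_cast habs
      rw [this]
    rw [habs, hsq]
    have : (5 ≤ (m : ℤ) + 1) ↔ 4 ≤ m := by omega
    simp only [this]

/-! ### Summation -/

/-- No sign of the radius of curvature is assumed, so that the bound applies to single harmonics. -/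
theorem abs_supportGap_le_of_abs {f : ℝ → ℝ} (hf : ContDiff ℝ 2 f) {M : ℝ}
    (hM : ∀ x, |f x + deriv (deriv f) x| < M) (φ : ℝ) {τ : ℝ} (h0 : τ ≠ 0) (h1 : |τ| ≤ Real.pi) :
    |supportGap f φ τ| ≤ M * (1 - Real.cos τ) := by
  have hd : deriv (fun x => -f x) = fun x => -deriv f x := funext fun x => deriv.fun_neg
  have h2 : deriv (deriv fun x => -f x) = fun x => -deriv (deriv f) x := by
    rw [hd]
    funext x
    exact deriv.fun_neg
  rw [abs_le]
  constructor
  · have := supportGap_lt_of_bound hf.neg (M := M) (fun x => by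
      change -f x + deriv (deriv fun x => -f x) x < M
      rw [h2]
      linarith [(abs_lt.1 (hM x)).1]) φ h0 h1
    change supportGap (fun x => -f x) φ τ < _ at this
    simp only [supportGap, hd] at this
    unfold supportGap
    linarith
  · exact (supportGap_lt_of_bound hf (fun x => (abs_lt.1 (hM x)).2) φ h0 h1).le

/-- The multiplier is the sum of the squared gaps at `φ = 0` of `cos(nx)` and `sin(nx)`, whose radii
of curvature are at most `n² + 1` in absolute value. The bound `n² + 2` makes this strict. -/
theorem gapMultiplier_le (n : ℤ) {τ : ℝ} (hτ : τ ∈ Ioo 0 Real.pi) :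
    gapMultiplier n τ ≤ 2 * (((n : ℝ) ^ 2 + 2) * (1 - Real.cos τ)) ^ 2 := by
  have habs : |τ| ≤ Real.pi := by rw [abs_of_pos hτ.1]; exact hτ.2.le
  have hm : ∀ x : ℝ, HasDerivAt (fun x : ℝ => (n : ℝ) * x) n x := fun x => by
    simpa using (hasDerivAt_id x).const_mul (n : ℝ)
  have dc : deriv (fun x : ℝ => Real.cos (n * x)) = fun x => -(n * Real.sin (n * x)) :=
    funext fun x => by rw [(hm x).cos.deriv]; ring
  have ds : deriv (fun x : ℝ => Real.sin (n * x)) = fun x => n * Real.cos (n * x) :=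
    funext fun x => by rw [(hm x).sin.deriv]; ring
  have dcc : deriv (deriv fun x : ℝ => Real.cos (n * x)) =
      fun x => -((n : ℝ) ^ 2 * Real.cos (n * x)) := by
    rw [dc]
    funext x
    rw [((hm x).sin.const_mul (n : ℝ)).fun_neg.deriv]
    ring
  have dss : deriv (deriv fun x : ℝ => Real.sin (n * x)) =
      fun x => -((n : ℝ) ^ 2 * Real.sin (n * x)) := by
    rw [ds]
    funext x
    rw [((hm x).cos.const_mul (n : ℝ)).deriv]
    ring
  have hbound : ∀ y : ℝ, |y| ≤ 1 → |y + -((n : ℝ) ^ 2 * y)| < (n : ℝ) ^ 2 + 2 := by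
    intro y hy
    calc |y + -((n : ℝ) ^ 2 * y)| ≤ |y| + |-((n : ℝ) ^ 2 * y)| := abs_add_le _ _
      _ = |y| * (1 + (n : ℝ) ^ 2) := by
        rw [abs_neg, abs_mul, abs_of_nonneg (sq_nonneg (n : ℝ))]
        ring
      _ ≤ 1 * (1 + (n : ℝ) ^ 2) := by gcongr
      _ < _ := by linarith
  have g1 := abs_supportGap_le_of_abs (f := fun x : ℝ => Real.cos (n * x)) (by fun_prop)
    (fun x => by rw [dcc]; exact hbound _ (Real.abs_cos_le_one _)) 0 hτ.1.ne' habs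
  have g2 := abs_supportGap_le_of_abs (f := fun x : ℝ => Real.sin (n * x)) (by fun_prop)
    (fun x => by rw [dss]; exact hbound _ (Real.abs_sin_le_one _)) 0 hτ.1.ne' habs
  simp only [supportGap, dc, ds, zero_add, mul_zero, Real.cos_zero, Real.sin_zero, one_mul,
    neg_zero, zero_mul, sub_zero, mul_one] at g1 g2
  have s1 := sq_le_sq' (by linarith [neg_le_of_abs_le g1]) (le_of_abs_le g1)
  have s2 := sq_le_sq' (by linarith [neg_le_of_abs_le g2]) (le_of_abs_le g2)
  unfold gapMultiplier
  linarith

theorem abs_angleKernel_mul_gapMultiplier_le (n : ℤ) {τ : ℝ} (hτ : τ ∈ Ioo 0 Real.pi) :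
    |angleKernel τ * gapMultiplier n τ| ≤ 64 * ((n : ℝ) ^ 2 + 2) ^ 2 := by
  have h2 := abs_angleKernel_mul_le hτ
  have h3 := one_sub_cos_pos hτ
  have h4 := Real.neg_one_le_cos τ
  have h5 : 0 ≤ gapMultiplier n τ := by unfold gapMultiplier; positivity
  rw [abs_mul, abs_of_nonneg h5]
  calc |angleKernel τ| * gapMultiplier n τ
      ≤ |angleKernel τ| * (2 * (((n : ℝ) ^ 2 + 2) * (1 - Real.cos τ)) ^ 2) := by
        gcongr
        exact gapMultiplier_le n hτ
    _ = (|angleKernel τ| * (1 - Real.cos τ)) * (2 * ((n : ℝ) ^ 2 + 2) ^ 2 * (1 - Real.cos τ)) := by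
        ring
    _ ≤ 16 * (2 * ((n : ℝ) ^ 2 + 2) ^ 2 * 2) := by gcongr; linarith
    _ = _ := by ring

/-- Parseval for each `τ`, followed by the exchange of sum and integral. The integrated terms are
dominated by multiples of `(n² + 2)² |c_n|²`, which is summable because `f''` is square integrable.
-/
theorem hasSum_integral_angleKernel {f : ℝ → ℝ} (hf : ContDiff ℝ 2 f)
    (hper : Function.Periodic f (2 * Real.pi)) :
    HasSum (fun n : ℤ => (∫ τ in Ioo 0 Real.pi, angleKernel τ * gapMultiplier n τ) *
        ‖coeff f n‖ ^ 2)
      ((2 * Real.pi)⁻¹ * ∫ τ in Ioo 0 Real.pi, angleKernel τ *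
        ∫ φ in (0 : ℝ)..(2 * Real.pi), supportGap f φ τ ^ 2) := by
  have hint : ∀ n, IntegrableOn (fun τ => angleKernel τ * gapMultiplier n τ) (Ioo 0 Real.pi) := by
    intro n
    refine IntegrableOn.of_bound (by simp)
      (ContinuousOn.aestronglyMeasurable ?_ measurableSet_Ioo) (64 * ((n : ℝ) ^ 2 + 2) ^ 2) ?_
    · refine continuousOn_angleKernel.mul (Continuous.continuousOn ?_)
      unfold gapMultiplier
      fun_prop
    · filter_upwards [ae_restrict_mem measurableSet_Ioo] with τ hτ
      exact abs_angleKernel_mul_gapMultiplier_le n hτ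
  have key := hasSum_integral_of_summable_integral_norm (μ := volume.restrict (Ioo 0 Real.pi))
    (F := fun (n : ℤ) τ => angleKernel τ * gapMultiplier n τ * ‖coeff f n‖ ^ 2)
    (fun n => (hint n).mul_const _) ?_
  · simp_rw [integral_mul_const, mul_assoc, tsum_mul_left,
      (hasSum_supportGap_sq hf hper _).tsum_eq] at key
    convert! key using 1
    rw [← integral_const_mul]
    congr 1
    funext τ
    ring
  · have h0 := (hasSum_norm_coeff_sq hf.continuous).summable
    have h2 := (hasSum_sq_deriv hf hper).summable
    have h4 := (hasSum_sq_deriv_deriv hf hper).summable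
    refine Summable.of_nonneg_of_le (fun n => integral_nonneg fun τ => norm_nonneg _) (fun n => ?_)
      (((h4.add (h2.mul_left 4)).add (h0.mul_left 4)).mul_left (64 * Real.pi))
    calc ∫ τ in Ioo 0 Real.pi, ‖angleKernel τ * gapMultiplier n τ * ‖coeff f n‖ ^ 2‖
        ≤ ∫ τ in Ioo 0 Real.pi, 64 * ((n : ℝ) ^ 2 + 2) ^ 2 * ‖coeff f n‖ ^ 2 := by
          refine setIntegral_mono_on ((hint n).mul_const _).norm (integrable_const _) measurableSet_Ioo
            fun τ hτ => ?_
          rw [norm_mul, norm_pow, norm_norm]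
          gcongr
          exact abs_angleKernel_mul_gapMultiplier_le n hτ
      _ = _ := by
          rw [setIntegral_const]
          simp [Real.pi_pos.le]
          ring

/-! ### Fourier series of the two sides of the inequality -/

theorem hasSum_half_integral_sub {a b : ℤ → ℝ} {u v : ℝ → ℝ} (hu : Continuous u)
    (hv : Continuous v)
    (ha : HasSum a ((2 * Real.pi)⁻¹ * ∫ x in (0 : ℝ)..(2 * Real.pi), u x))
    (hb : HasSum b ((2 * Real.pi)⁻¹ * ∫ x in (0 : ℝ)..(2 * Real.pi), v x)) :
    HasSum (fun n => Real.pi * (a n - b n))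
      (1 / 2 * ∫ x in (0 : ℝ)..(2 * Real.pi), (u x - v x)) := by
  convert! (ha.sub hb).mul_left Real.pi using 1
  rw [intervalIntegral.integral_sub (hu.intervalIntegrable _ _) (hv.intervalIntegrable _ _)]
  field_simp

theorem hasSum_signedArea {f : ℝ → ℝ} (hf : ContDiff ℝ 2 f)
    (hper : Function.Periodic f (2 * Real.pi)) :
    HasSum (fun n : ℤ => Real.pi * (‖coeff f n‖ ^ 2 - (n : ℝ) ^ 2 * ‖coeff f n‖ ^ 2))
      (signedArea f) :=
  hasSum_half_integral_sub (hf.continuous.pow 2) ((continuous_deriv_of_contDiff hf).pow 2)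
    (hasSum_norm_coeff_sq hf.continuous) (hasSum_sq_deriv hf hper)

theorem signedArea_evoluteSupport {f : ℝ → ℝ} (hper : Function.Periodic f (2 * Real.pi)) :
    signedArea (evoluteSupport f) =
      1 / 2 * ∫ θ in (0 : ℝ)..(2 * Real.pi), (deriv f θ ^ 2 - deriv (deriv f) θ ^ 2) := by
  have h1 : ∀ θ, deriv (evoluteSupport f) θ = deriv (deriv f) (θ - Real.pi / 2) := fun θ =>
    deriv_comp_sub_const (f := deriv f) (a := Real.pi / 2) (x := θ)
  set G : ℝ → ℝ := fun θ => deriv f θ ^ 2 - deriv (deriv f) θ ^ 2 with hG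
  have hGper : Function.Periodic G (2 * Real.pi) := fun θ => by
    simp only [hG, periodic_deriv hper θ, periodic_deriv (periodic_deriv hper) θ]
  have h2 := intervalIntegral.integral_comp_sub_right (a := 0) (b := 2 * Real.pi) G (Real.pi / 2)
  have h3 := hGper.intervalIntegral_add_eq (0 - Real.pi / 2) 0
  rw [zero_add, show 0 - Real.pi / 2 + 2 * Real.pi = 2 * Real.pi - Real.pi / 2 by ring] at h3
  rw [signedArea]
  simp_rw [h1]
  change 1 / 2 * (∫ θ in (0 : ℝ)..(2 * Real.pi), G (θ - Real.pi / 2)) = _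
  rw [h2, h3]

theorem hasSum_evoluteArea {K : Set Plane} (hK : IsStrictlyConvexC2 K) :
    HasSum (fun n : ℤ => Real.pi * ((n : ℝ) ^ 2 * ‖coeff (supportFun K) n‖ ^ 2 -
      (n : ℝ) ^ 4 * ‖coeff (supportFun K) n‖ ^ 2)) (evoluteArea K) := by
  have hf := hK.contDiff
  have hper := supportFun_periodic K
  rw [evoluteArea, signedArea_evoluteSupport hper]
  exact hasSum_half_integral_sub ((continuous_deriv_of_contDiff hf).pow 2)
    ((continuous_deriv_deriv_of_contDiff hf).pow 2)
    (hasSum_sq_deriv hf hper) (hasSum_sq_deriv_deriv hf hper)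

theorem one_le_sq_of_ne_zero {n : ℤ} (hn : n ≠ 0) : (1 : ℝ) ≤ (n : ℝ) ^ 2 := by
  have : 1 ≤ n ^ 2 := by have := sq_nonneg n; have := pow_ne_zero 2 hn; omega
  exact_mod_cast this

/-- Every term `n²(1 - n²)|c_n|²` of the signed area is `≤ 0` for integer `n`, so the absolute value
only changes the sign. -/
theorem hasSum_abs_evoluteArea {K : Set Plane} (hK : IsStrictlyConvexC2 K) :
    HasSum (fun n : ℤ => Real.pi * ((n : ℝ) ^ 2 * ((n : ℝ) ^ 2 - 1) *
      ‖coeff (supportFun K) n‖ ^ 2)) |evoluteArea K| := by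
  have h := hasSum_evoluteArea hK
  have hle : evoluteArea K ≤ 0 := by
    refine h.nonpos fun n => ?_
    rcases eq_or_ne n 0 with rfl | hn
    · simp
    · have h1 := one_le_sq_of_ne_zero hn
      have h2 : 0 ≤ Real.pi * ((n : ℝ) ^ 2 * ((n : ℝ) ^ 2 - 1) * ‖coeff (supportFun K) n‖ ^ 2) :=
        mul_nonneg Real.pi_pos.le (mul_nonneg (mul_nonneg (sq_nonneg _) (by linarith))
          (sq_nonneg _))
      linarith
  rw [abs_of_nonpos hle]
  refine h.neg.congr_fun fun n => ?_
  ring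

/-- Since `L = 2π c_0`, the term `L²` cancels exactly the term `n = 0` of `4πF`. -/
theorem hasSum_isoDeficit {K : Set Plane} (hK : IsStrictlyConvexC2 K) :
    HasSum (fun n : ℤ => if n = 0 then 0 else
      4 * Real.pi ^ 2 * (((n : ℝ) ^ 2 - 1) * ‖coeff (supportFun K) n‖ ^ 2)) (isoDeficit K) := by
  have hpi := Real.pi_pos
  have hF := hasSum_signedArea hK.contDiff (supportFun_periodic K)
  rw [← volume_real_eq hK] at hF
  have hL : boundaryLength K ^ 2 = 4 * Real.pi ^ 2 * ‖coeff (supportFun K) 0‖ ^ 2 := by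
    rw [coeff_zero, Complex.norm_real, Real.norm_eq_abs, sq_abs, boundaryLength_eq hK]
    field_simp
    ring
  have h := (hasSum_ite_eq (0 : ℤ) (boundaryLength K ^ 2)).sub (hF.mul_left (4 * Real.pi))
  refine h.congr_fun fun n => ?_
  rw [hL]
  split_ifs with hn
  · subst hn
    simp
    ring
  · ring

section ConstantWidth

variable {K : Set Plane}

theorem coeff_supportFun_eq_zero (hK : IsStrictlyConvexC2 K) (hw : HasConstantWidth K) {n : ℤ}
    (hn : Even n) (hn0 : n ≠ 0) : coeff (supportFun K) n = 0 := by
  obtain ⟨w, hw⟩ := supportFun_add_eq_of_constantWidth hK.nonempty hK.isCompact hK.convex hw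
  exact coeff_eq_zero_of_constantWidth hK.contDiff.continuous (supportFun_periodic K) hw hn hn0

/-- The coefficient `(4π²/9)(n²(n²-1) - 9(n²-1))` factors and vanishes for `n = ±1, ±3`, and the
even `n ≠ 0` drop out by constant width. This is why `4/9` is the right constant. -/
theorem hasSum_widthDeficit (hK : IsStrictlyConvexC2 K) (hw : HasConstantWidth K) :
    HasSum (fun n : ℤ => 4 * Real.pi ^ 2 / 9 * (if 5 ≤ |n| then
      ((n : ℝ) ^ 2 - 1) * ((n : ℝ) ^ 2 - 9) * ‖coeff (supportFun K) n‖ ^ 2 else 0))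
      (widthDeficit K) := by
  have h := ((hasSum_abs_evoluteArea hK).mul_left (4 / 9 * Real.pi)).sub (hasSum_isoDeficit hK)
  refine h.congr_fun fun n => ?_
  rcases eq_or_ne n 0 with rfl | hn
  · simp
  rw [if_neg hn]
  rcases Int.even_or_odd n with he | ho
  · simp [coeff_supportFun_eq_zero hK hw he hn]
  split_ifs with h5
  · ring
  · rw [not_le, abs_lt] at h5
    obtain ⟨h1, h2⟩ := h5
    obtain ⟨k, rfl⟩ := ho
    obtain rfl | rfl | rfl | rfl : k = -2 ∨ k = -1 ∨ k = 0 ∨ k = 1 := by omega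
    all_goals push_cast; ring

theorem hasSum_visualBound (hK : IsStrictlyConvexC2 K) (hw : HasConstantWidth K) :
    HasSum (fun n : ℤ => 4 * Real.pi ^ 2 / 9 * (if 5 ≤ |n| then
      ((n : ℝ) ^ 2 - 1) * 16 * ‖coeff (supportFun K) n‖ ^ 2 else 0)) (visualBound K) := by
  have hpi := Real.pi_pos
  -- The factor is `64/9 · ½ · 2π`: the `½` comes from the integration by parts and the `2π` undoes
  -- the normalization in Parseval.
  have h := (hasSum_integral_angleKernel hK.contDiff (supportFun_periodic K)).mul_left
    (64 / 9 * Real.pi)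
  rw [visualBound, (angle_integral hK).2]
  convert! h using 1
  · funext n
    by_cases hn : n = 0 ∨ Odd n
    · rw [integral_angleKernel_mul_gapMultiplier hn]
      split_ifs <;> ring
    · rw [not_or, Int.not_odd_iff_even] at hn
      simp [coeff_supportFun_eq_zero hK hw hn.2 hn.1]
  · field_simp

theorem sq_ge_of_le_abs {n : ℤ} (hn : 5 ≤ |n|) : (25 : ℝ) ≤ (n : ℝ) ^ 2 := by
  have : (25 : ℤ) ≤ n ^ 2 := by
    rw [← sq_abs]
    nlinarith
  exact_mod_cast this

/-- Termwise, `n² - 9 ≥ 16` as soon as `|n| ≥ 5`. -/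
theorem visualBound_le_widthDeficit (hK : IsStrictlyConvexC2 K) (hw : HasConstantWidth K) :
    visualBound K ≤ widthDeficit K := by
  refine hasSum_le (fun n => ?_) (hasSum_visualBound hK hw) (hasSum_widthDeficit hK hw)
  refine mul_le_mul_of_nonneg_left ?_ (by positivity)
  split_ifs with h
  · have := sq_ge_of_le_abs h
    gcongr
    · linarith
    · linarith
  · exact le_rfl

theorem visualBound_eq_zero_iff (hK : IsStrictlyConvexC2 K) (hw : HasConstantWidth K) :
    visualBound K = 0 ↔ ∀ n : ℤ, 5 ≤ |n| → coeff (supportFun K) n = 0 := by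
  have h := hasSum_visualBound hK hw
  have hpi := Real.pi_pos
  constructor
  · intro h0 n hn
    rw [h0, hasSum_zero_iff_of_nonneg] at h
    · have := congrFun h n
      have h1 := sq_ge_of_le_abs hn
      have h2 : ((n : ℝ) ^ 2 - 1) ≠ 0 := by linarith
      simpa [hn, h2, hpi.ne'] using this
    · intro n
      refine mul_nonneg (by positivity) ?_
      split_ifs with hn
      · have h1 := sq_ge_of_le_abs hn
        exact mul_nonneg (mul_nonneg (by linarith) (by norm_num)) (sq_nonneg _)
      · exact le_rfl
  · intro h0
    refine h.unique (hasSum_zero.congr_fun fun n => ?_)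
    split_ifs with hn
    · simp [h0 n hn]
    · simp

theorem visualBound_nonneg (hK : IsStrictlyConvexC2 K) (hw : HasConstantWidth K) :
    0 ≤ visualBound K := by
  refine (hasSum_visualBound hK hw).nonneg fun n => mul_nonneg (by positivity) ?_
  split_ifs with hn
  · have h1 := sq_ge_of_le_abs hn
    exact mul_nonneg (mul_nonneg (by linarith) (by norm_num)) (sq_nonneg _)
  · exact le_rfl

theorem widthDeficit_eq_zero_of_visualBound_eq_zero (hK : IsStrictlyConvexC2 K)
    (hw : HasConstantWidth K) (h : visualBound K = 0) : widthDeficit K = 0 := by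
  rw [visualBound_eq_zero_iff hK hw] at h
  refine (hasSum_widthDeficit hK hw).unique (hasSum_zero.congr_fun fun n => ?_)
  split_ifs with hn
  · simp [h n hn]
  · simp

/-- The difference has the nonnegative terms `(n²-1)(n²-25)|c_n|²`, and for `|n| ≥ 5` the factor
vanishes only at `|n| = 5`. -/
theorem widthDeficit_eq_visualBound_iff (hK : IsStrictlyConvexC2 K) (hw : HasConstantWidth K) :
    widthDeficit K = visualBound K ↔ ∀ n : ℤ, 5 < |n| → coeff (supportFun K) n = 0 := by
  have h := (hasSum_widthDeficit hK hw).sub (hasSum_visualBound hK hw)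
  have hpi := Real.pi_pos
  have hterm : ∀ n : ℤ, 4 * Real.pi ^ 2 / 9 * (if 5 ≤ |n| then
      ((n : ℝ) ^ 2 - 1) * ((n : ℝ) ^ 2 - 9) * ‖coeff (supportFun K) n‖ ^ 2 else 0) -
      4 * Real.pi ^ 2 / 9 * (if 5 ≤ |n| then
        ((n : ℝ) ^ 2 - 1) * 16 * ‖coeff (supportFun K) n‖ ^ 2 else 0) =
      4 * Real.pi ^ 2 / 9 * (if 5 ≤ |n| then
        ((n : ℝ) ^ 2 - 1) * ((n : ℝ) ^ 2 - 25) * ‖coeff (supportFun K) n‖ ^ 2 else 0) := by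
    intro n
    split_ifs <;> ring
  simp_rw [hterm] at h
  rw [← sub_eq_zero]
  constructor
  · intro h0 n hn
    rw [h0, hasSum_zero_iff_of_nonneg] at h
    · have := congrFun h n
      have h1 := sq_ge_of_le_abs hn.le
      have h2 : ((n : ℝ) ^ 2 - 1) ≠ 0 := by linarith
      have h3 : ((n : ℝ) ^ 2 - 25) ≠ 0 := by
        have : (25 : ℤ) < n ^ 2 := by
          rw [← sq_abs]
          nlinarith
        have : (25 : ℝ) < (n : ℝ) ^ 2 := by exact_mod_cast this
        linarith
      simpa [hn.le, h2, h3, hpi.ne'] using this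
    · intro n
      refine mul_nonneg (by positivity) ?_
      split_ifs with hn
      · have h1 := sq_ge_of_le_abs hn
        exact mul_nonneg (mul_nonneg (by linarith) (by linarith)) (sq_nonneg _)
      · exact le_rfl
  · intro h0
    refine h.unique (hasSum_zero.congr_fun fun n => ?_)
    split_ifs with hn
    · rcases hn.lt_or_eq with hn | hn
      · simp [h0 n hn]
      · have : (n : ℝ) ^ 2 = 25 := by
          have : n ^ 2 = 25 := by rw [← sq_abs, ← hn]; norm_num
          exact_mod_cast this
        rw [this]
        simp
    · simp

end ConstantWidth

/-! ### Trigonometric polynomials and hypocycloids -/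

/-- Finitely many nonzero coefficients are summable, so the Fourier series of the continuous
function on the circle converges pointwise to it. -/
theorem fourier_expansion {f : ℝ → ℝ} (hf : Continuous f)
    (hper : Function.Periodic f (2 * Real.pi)) {s : Finset ℤ} (hs : ∀ n ∉ s, coeff f n = 0)
    (x : ℝ) : (f x : ℂ) = ∑ n ∈ s, coeff f n * Complex.exp (n * x * Complex.I) := by
  have : Fact (0 < 2 * Real.pi) := ⟨Real.two_pi_pos⟩
  have hp : Function.Periodic (fun x => (f x : ℂ)) (2 * Real.pi) := fun x => by simp only [hper x]
  let g : C(AddCircle (2 * Real.pi), ℂ) :=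
    ⟨hp.lift, (by fun_prop : Continuous fun x => (f x : ℂ)).quotient_liftOn' _⟩
  have hg : ∀ y : ℝ, g (y : AddCircle (2 * Real.pi)) = f y := fun y => hp.lift_coe y
  have hcoeff : ∀ n, fourierCoeff g n = coeff f n := fun n => by
    rw [fourierCoeff_eq_intervalIntegral g n 0, coeff_eq_fourierCoeffOn, fourierCoeffOn_eq_integral,
      zero_add]
    simp only [hg, fourier_coe_apply, sub_zero]
  have hsum : HasSum (fun n => fourierCoeff g n • fourier n (x : AddCircle (2 * Real.pi)))
      (∑ n ∈ s, fourierCoeff g n • fourier n (x : AddCircle (2 * Real.pi))) :=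
    hasSum_sum_of_ne_finset_zero fun n hn => by simp [hcoeff, hs n hn]
  have hsummable : Summable (fourierCoeff g) :=
    summable_of_ne_finset_zero (s := s) fun n hn => by rw [hcoeff, hs n hn]
  have h := (has_pointwise_sum_fourier_series_of_summable hsummable x).unique hsum
  rw [hg] at h
  rw [h]
  refine Finset.sum_congr rfl fun n _ => ?_
  rw [hcoeff, smul_eq_mul, fourier_coe_apply]
  congr 2
  have : (Real.pi : ℂ) ≠ 0 := by exact_mod_cast Real.pi_ne_zero
  push_cast
  field_simp

/-- A trigonometric polynomial with frequencies `0`, `1`, `3` and `5`. -/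
def trigSum (a : ℝ) (c u v : Plane) (φ : ℝ) : ℝ :=
  a + inner ℝ c (dirN φ) + inner ℝ u (dirN (3 * φ)) + inner ℝ v (dirN (5 * φ))

theorem re_mul_exp (z : ℂ) (x : ℝ) : (z * Complex.exp (x * Complex.I)).re =
    z.re * Real.cos x - z.im * Real.sin x := by
  rw [Complex.exp_mul_I]
  simp [Complex.cos_ofReal_re, Complex.sin_ofReal_re]

theorem exists_eq_trigSum {f : ℝ → ℝ} (hf : Continuous f)
    (hper : Function.Periodic f (2 * Real.pi))
    (h : ∀ n : ℤ, 5 < |n| → coeff f n = 0) (heven : ∀ n : ℤ, Even n → n ≠ 0 → coeff f n = 0) :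
    ∃ (a : ℝ) (c u v : Plane), ∀ φ, f φ = trigSum a c u v φ := by
  have hs : ∀ n ∉ ({0, 1, -1, 3, -3, 5, -5} : Finset ℤ), coeff f n = 0 := by
    intro n hn
    rcases lt_or_ge 5 |n| with h5 | h5
    · exact h n h5
    · rcases Int.even_or_odd n with he | ⟨k, rfl⟩
      · exact heven n he (by rintro rfl; simp at hn)
      · rw [abs_le] at h5
        simp only [Finset.mem_insert, Finset.mem_singleton, not_or] at hn
        omega
  -- The vectors collect the real parts of the terms of index `n` and `-n`; the symmetry `c_{-n} =
  -- conj c_n` is not needed.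
  refine ⟨(coeff f 0).re,
    !₂[(coeff f 1).re + (coeff f (-1)).re, (coeff f (-1)).im - (coeff f 1).im],
    !₂[(coeff f 3).re + (coeff f (-3)).re, (coeff f (-3)).im - (coeff f 3).im],
    !₂[(coeff f 5).re + (coeff f (-5)).re, (coeff f (-5)).im - (coeff f 5).im], fun φ => ?_⟩
  have e := congrArg Complex.re (fourier_expansion hf hper hs φ)
  have hre : ∀ n : ℤ, (coeff f n * Complex.exp (n * φ * Complex.I)).re =
      (coeff f n).re * Real.cos (n * φ) - (coeff f n).im * Real.sin (n * φ) := fun n => by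
    rw [← re_mul_exp]
    push_cast
    rfl
  rw [Complex.ofReal_re, Complex.re_sum] at e
  simp only [hre] at e
  rw [e, Finset.sum_insert (by decide), Finset.sum_insert (by decide),
    Finset.sum_insert (by decide), Finset.sum_insert (by decide), Finset.sum_insert (by decide),
    Finset.sum_insert (by decide), Finset.sum_singleton]
  simp [trigSum, inner_dirN]
  ring

theorem hasDerivAt_inner_dirN_mul (v : Plane) (k x : ℝ) :
    HasDerivAt (fun x => inner ℝ v (dirN (k * x))) (k * inner ℝ v (dirT (k * x))) x := by
  have hk : HasDerivAt (fun x : ℝ => k * x) k x := by simpa using (hasDerivAt_id x).const_mul k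
  have h := (hasDerivAt_const x v).inner ℝ ((hasDerivAt_dirN (k * x)).scomp x hk)
  refine h.congr_deriv ?_
  simp [real_inner_smul_right]

theorem hasDerivAt_inner_dirT_mul (v : Plane) (k x : ℝ) :
    HasDerivAt (fun x => inner ℝ v (dirT (k * x))) (-k * inner ℝ v (dirN (k * x))) x := by
  have hk : HasDerivAt (fun x : ℝ => k * x) k x := by simpa using (hasDerivAt_id x).const_mul k
  have h := (hasDerivAt_const x v).inner ℝ ((hasDerivAt_dirT (k * x)).scomp x hk)
  refine h.congr_deriv ?_
  simp [real_inner_smul_right]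

theorem inner_dirN_mul_periodic (v : Plane) (k : ℕ) :
    Function.Periodic (fun x => inner ℝ v (dirN (k * x))) (2 * Real.pi) := fun x => by
  simp only [mul_add]
  rw [dirN_periodic.nat_mul k (k * x)]

theorem inner_dirT_mul_periodic (v : Plane) (k : ℕ) :
    Function.Periodic (fun x => inner ℝ v (dirT (k * x))) (2 * Real.pi) := fun x => by
  simp only [mul_add]
  rw [dirT_periodic.nat_mul k (k * x)]

theorem contDiff_dirN : ContDiff ℝ 2 dirN := by
  refine contDiff_euclidean.2 fun i => ?_
  fin_cases i
  · exact Real.contDiff_cos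
  · exact Real.contDiff_sin

theorem continuous_inner_dirN_mul (v : Plane) (k : ℝ) :
    Continuous fun x => inner ℝ v (dirN (k * x)) :=
  continuous_iff_continuousAt.2 fun x => (hasDerivAt_inner_dirN_mul v k x).continuousAt

theorem coeff_inner_dirN_mul (v : Plane) (k : ℕ) {n : ℤ} (hn : (n : ℝ) ^ 2 ≠ (k : ℝ) ^ 2) :
    coeff (fun x => inner ℝ v (dirN (k * x))) n = 0 := by
  refine coeff_eq_zero_of_deriv_deriv (k := k) (hasDerivAt_inner_dirN_mul v k) (fun x => ?_)
    (inner_dirN_mul_periodic v k) (fun x => ?_) hn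
  · refine ((hasDerivAt_inner_dirT_mul v k x).const_mul (k : ℝ)).congr_deriv ?_
    ring
  · have := inner_dirT_mul_periodic v k x
    simp only at this
    simp only [this]

theorem coeff_trigSum (a : ℝ) (c u v : Plane) {n : ℤ} (hn : 5 < |n|) :
    coeff (trigSum a c u v) n = 0 := by
  have hsq : (25 : ℝ) < (n : ℝ) ^ 2 := by
    have : (25 : ℤ) < n ^ 2 := by
      rw [← sq_abs]
      nlinarith
    exact_mod_cast this
  have h0 : n ≠ 0 := by
    rintro rfl
    simp at hn
  have h1 := coeff_inner_dirN_mul c 1 (n := n) (fun h => by push_cast at h; linarith)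
  have h3 := coeff_inner_dirN_mul u 3 (n := n) (fun h => by push_cast at h; linarith)
  have h5 := coeff_inner_dirN_mul v 5 (n := n) (fun h => by push_cast at h; linarith)
  have c1 := continuous_inner_dirN_mul c 1
  have c3 := continuous_inner_dirN_mul u 3
  have c5 := continuous_inner_dirN_mul v 5
  simp only [one_mul, Nat.cast_one, Nat.cast_ofNat] at h1 h3 h5 c1
  unfold trigSum
  rw [coeff_add (by fun_prop) c5, coeff_add (by fun_prop) c3, coeff_add (by fun_prop) c1,
    coeff_const h0, h1, h3, h5]
  simp

/-! ### Hypocycloids -/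

theorem inner_rotate_dirN (α s : ℝ) (v : Plane) :
    inner ℝ (rotate α v) (dirN (α + s)) = inner ℝ v (dirN s) := by
  simp only [inner_dirN, rotate, Real.cos_add, Real.sin_add]
  simp
  linear_combination (v 0 * Real.cos s + v 1 * Real.sin s) * Real.sin_sq_add_cos_sq α

theorem inner_rotate_dirT (α s : ℝ) (v : Plane) :
    inner ℝ (rotate α v) (dirT (α + s)) = inner ℝ v (dirT s) := by
  simp only [inner_dirT, rotate, Real.cos_add, Real.sin_add]
  simp
  linear_combination (v 1 * Real.cos s - v 0 * Real.sin s) * Real.sin_sq_add_cos_sq α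

/-- In the frame turning with the normal angle `(k-2)t/2`, the two circular motions of the
hypocycloid combine into one harmonic of frequency `k/2` in `t`, that is, of frequency `k/(k-2)` in
the normal angle. -/
theorem inner_hypocycloid_dirN (r k t : ℝ) : inner ℝ (hypocycloid r k t) (dirN ((k - 2) / 2 * t)) =
    r * (k - 2) * Real.sin (k / 2 * t) := by
  have h1 := Real.sin_add t ((k - 2) / 2 * t)
  have h2 := Real.sin_sub ((k - 1) * t) ((k - 2) / 2 * t)
  rw [show t + (k - 2) / 2 * t = k / 2 * t by ring] at h1
  rw [show (k - 1) * t - (k - 2) / 2 * t = k / 2 * t by ring] at h2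
  simp only [inner_dirN, hypocycloid]
  simp
  linear_combination -r * (k - 1) * h1 + r * h2

theorem inner_hypocycloid_dirT (r k t : ℝ) : inner ℝ (hypocycloid r k t) (dirT ((k - 2) / 2 * t)) =
    r * k * Real.cos (k / 2 * t) := by
  have h1 := Real.cos_add t ((k - 2) / 2 * t)
  have h2 := Real.cos_sub ((k - 1) * t) ((k - 2) / 2 * t)
  rw [show t + (k - 2) / 2 * t = k / 2 * t by ring] at h1
  rw [show (k - 1) * t - (k - 2) / 2 * t = k / 2 * t by ring] at h2
  simp only [inner_dirT, hypocycloid]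
  simp
  linear_combination -r * (k - 1) * h1 - r * h2

theorem eq_of_envelope_eq_hypocycloid {f : ℝ → ℝ} {r k α : ℝ} {c : Plane} (hk : k ≠ 2)
    (h : ∀ t, envelope f (α + (k - 2) / 2 * t) = c + rotate α (hypocycloid r k t)) (φ : ℝ) :
    f φ = inner ℝ c (dirN φ) + r * (k - 2) * Real.sin (k / (k - 2) * (φ - α)) := by
  have hk2 : k - 2 ≠ 0 := sub_ne_zero.2 hk
  have e := h (2 * (φ - α) / (k - 2))
  have e1 : (k - 2) / 2 * (2 * (φ - α) / (k - 2)) = φ - α := by field_simp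
  have e2 : k / 2 * (2 * (φ - α) / (k - 2)) = k / (k - 2) * (φ - α) := by field_simp
  have h1 := inner_hypocycloid_dirN r k (2 * (φ - α) / (k - 2))
  rw [e1, e2, ← inner_rotate_dirN α, add_sub_cancel] at h1
  rw [e1, add_sub_cancel] at e
  rw [← h1, ← inner_add_left, ← e, inner_envelope_dirN]

theorem inner_dirT_dirN_eq_sin (x y : ℝ) : inner ℝ (dirT x) (dirN y) = Real.sin (y - x) := by
  simp only [inner_dirN, dirT_zero, dirT_one, Real.sin_sub]
  ring

theorem exists_eq_of_isHypocycloidSupport_three {f : ℝ → ℝ} (h : IsHypocycloidSupport 3 f) :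
    ∃ c u : Plane, ∀ φ, f φ = inner ℝ c (dirN φ) + inner ℝ u (dirN (3 * φ)) := by
  obtain ⟨-, -, n, hn, -, hn2, r, α, c, -, h⟩ := h
  obtain rfl : n = 1 := by omega
  refine ⟨c, r • dirT (3 * α), fun φ => ?_⟩
  rw [eq_of_envelope_eq_hypocycloid (by norm_num) h φ, real_inner_smul_left,
    inner_dirT_dirN_eq_sin, ← mul_sub]
  norm_num

/-- Both `k = 5` and `k = 5/2` have five cusps. The first has frequency `5/3` in the normal angle
and violates `2π`-periodicity, as the values at `α` and `α + 2π` show. The second has frequency `5`.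
-/
theorem exists_eq_of_isHypocycloidSupport_five {f : ℝ → ℝ} (h : IsHypocycloidSupport 5 f) :
    ∃ c u : Plane, ∀ φ, f φ = inner ℝ c (dirN φ) + inner ℝ u (dirN (5 * φ)) := by
  obtain ⟨-, hper, n, hn, -, hn2, r, α, c, hr, h⟩ := h
  obtain rfl | rfl : n = 1 ∨ n = 2 := by omega
  · exfalso
    have h1 := eq_of_envelope_eq_hypocycloid (by norm_num) h α
    have h2 := eq_of_envelope_eq_hypocycloid (by norm_num) h (α + 2 * Real.pi)
    rw [hper, dirN_periodic, h1] at h2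
    norm_num at h2
    have h3 : Real.sin (5 / 3 * (2 * Real.pi)) = -Real.sin (Real.pi / 3) := by
      rw [show 5 / 3 * (2 * Real.pi) = Real.pi / 3 + Real.pi + 2 * Real.pi by ring,
        Real.sin_add_two_pi, Real.sin_add_pi]
    have h4 : 0 < Real.sin (Real.pi / 3) :=
      Real.sin_pos_of_pos_of_lt_pi (by positivity) (by linarith [Real.pi_pos])
    rw [h3] at h2
    rcases h2 with h2 | h2 <;> linarith
  · refine ⟨c, (r / 2) • dirT (5 * α), fun φ => ?_⟩
    have e1 : ((5 : ℕ) : ℝ) / (2 : ℕ) - 2 = 1 / 2 := by norm_num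
    have e2 : ((5 : ℕ) : ℝ) / (2 : ℕ) / (1 / 2) = 5 := by norm_num
    rw [eq_of_envelope_eq_hypocycloid (by norm_num) h φ, real_inner_smul_left,
      inner_dirT_dirN_eq_sin, ← mul_sub, e1, e2]
    ring

theorem exists_inner_dirN_eq_sin (u : Plane) {m : ℝ} (hm : m ≠ 0) :
    ∃ α, u = ‖u‖ • dirT (m * α) := by
  obtain ⟨θ, hθ⟩ := exists_eq_norm_smul_dirN u
  refine ⟨(θ - Real.pi / 2) / m, ?_⟩
  rw [mul_div_cancel₀ _ hm]
  have : dirT (θ - Real.pi / 2) = dirN θ :=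
    plane_ext (by simp [Real.sin_sub_pi_div_two]) (by simp [Real.cos_sub_pi_div_two])
  rw [this]
  exact hθ

/-- For `k = (2n+1)/n` one has `k - 2 = 1/n` and `k/(k-2) = 2n+1`, so every harmonic of odd
frequency `2n+1 ≥ 3` is realized by a hypocycloid. -/
theorem isHypocycloidSupport_of_eq {f : ℝ → ℝ} {n : ℕ} (hn : 0 < n) {c u : Plane} (hu : u ≠ 0)
    (h : ∀ φ, f φ = inner ℝ c (dirN φ) + inner ℝ u (dirN ((2 * n + 1 : ℕ) * φ))) :
    IsHypocycloidSupport (2 * n + 1) f := by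
  have hn0 : (n : ℝ) ≠ 0 := by positivity
  obtain rfl : f = fun φ => inner ℝ c (dirN φ) + inner ℝ u (dirN ((2 * n + 1 : ℕ) * φ)) := funext h
  have hN := contDiff_dirN
  refine ⟨?_, ?_, n, hn, ?_, by omega, ?_⟩
  · exact (contDiff_const.inner ℝ hN).add
      (contDiff_const.inner ℝ (hN.comp (contDiff_const.mul contDiff_id)))
  · exact fun φ => by
      have := inner_dirN_mul_periodic u (2 * n + 1) φ
      simp only at this
      simp only [dirN_periodic φ, this]
  · simp [Nat.coprime_comm]
  · obtain ⟨α, hα⟩ := exists_inner_dirN_eq_sin u (m := (2 * n + 1 : ℕ)) (by positivity)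
    -- The radius is determined by the amplitude: `r (k - 2) = ‖u‖`.
    refine ⟨n * ‖u‖, α, c, mul_pos (by positivity) (norm_pos_iff.2 hu), fun t => ?_⟩
    set k : ℝ := ((2 * n + 1 : ℕ) : ℝ) / n with hk
    have hk2 : k - 2 = 1 / n := by
      rw [hk]
      push_cast
      field_simp
      ring
    have hsin : ((2 * n + 1 : ℕ) : ℝ) * (α + (k - 2) / 2 * t) - (2 * n + 1 : ℕ) * α = k / 2 * t := by
      rw [hk2, hk]
      field_simp
      ring
    refine eq_of_inner_eq (α + (k - 2) / 2 * t) ?_ ?_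
    · rw [inner_envelope_dirN, inner_add_left, inner_rotate_dirN, inner_hypocycloid_dirN, hα,
        real_inner_smul_left, inner_dirT_dirN_eq_sin, hsin, hk2, ← hα]
      field_simp
    · have hd := (hasDerivAt_inner_dirN_mul c 1 (α + (k - 2) / 2 * t)).add
        (hasDerivAt_inner_dirN_mul u (2 * n + 1 : ℕ) (α + (k - 2) / 2 * t))
      simp only [one_mul] at hd
      have hT : ∀ x y : ℝ, inner ℝ (dirT x) (dirT y) = Real.cos (y - x) := fun x y => by
        simp only [inner_dirT, dirT_zero, dirT_one, Real.cos_sub]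
        ring
      rw [inner_envelope_dirT, inner_add_left, inner_rotate_dirT, inner_hypocycloid_dirT]
      refine hd.deriv.trans ?_
      rw [hα, real_inner_smul_left, hT, hsin, ← hα, hk]
      field_simp

/-! ### The equality case -/

theorem exists_eq_trigSum_of_three {f : ℝ → ℝ} (h : IsParallelToHypocycloid 3 f) :
    ∃ (a : ℝ) (c u v : Plane), ∀ φ, f φ = trigSum a c u v φ := by
  obtain ⟨g, hg, d, h⟩ := h
  obtain ⟨c, u, hg⟩ := exists_eq_of_isHypocycloidSupport_three hg
  refine ⟨d, c, u, 0, fun φ => ?_⟩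
  rw [h, hg, trigSum, inner_zero_left]
  ring

theorem exists_eq_trigSum_of_five {f : ℝ → ℝ} (h : IsParallelToHypocycloid 5 f) :
    ∃ (a : ℝ) (c u v : Plane), ∀ φ, f φ = trigSum a c u v φ := by
  obtain ⟨g, hg, d, h⟩ := h
  obtain ⟨c, u, hg⟩ := exists_eq_of_isHypocycloidSupport_five hg
  refine ⟨d, c, 0, u, fun φ => ?_⟩
  rw [h, hg, trigSum, inner_zero_left]
  ring

theorem exists_eq_trigSum_of_closedBall (c : Plane) {R : ℝ} (hR : 0 < R) :
    ∃ (a : ℝ) (c' u v : Plane), ∀ φ,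
      supportFun (Metric.closedBall c R) φ = trigSum a c' u v φ := by
  refine ⟨R, c, 0, 0, fun φ => ?_⟩
  rw [supportFun_closedBall c hR.le, trigSum, inner_zero_left, inner_zero_left]
  ring

theorem exists_eq_trigSum_of_isMinkowskiSum {K : Set Plane} (h : IsMinkowskiSum K) :
    ∃ (a : ℝ) (c u v : Plane), ∀ φ, supportFun K φ = trigSum a c u v φ := by
  obtain ⟨n, f, hf, h⟩ := h
  have hf' : ∀ i, ∃ (a : ℝ) (c u v : Plane), ∀ φ, f i φ = trigSum a c u v φ := by
    intro i
    rcases hf i with ⟨c, R, hR, hi⟩ | hi | hi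
    · rw [hi]
      exact exists_eq_trigSum_of_closedBall c hR
    · exact exists_eq_trigSum_of_three hi
    · exact exists_eq_trigSum_of_five hi
  choose a c u v hf' using hf'
  refine ⟨∑ i, a i, ∑ i, c i, ∑ i, u i, ∑ i, v i, fun φ => ?_⟩
  simp only [h, hf', trigSum, sum_inner, Finset.sum_add_distrib]

theorem isParallelToHypocycloid_three {f : ℝ → ℝ} {a : ℝ} {c u : Plane} (hu : u ≠ 0)
    (h : ∀ φ, f φ = trigSum a c u 0 φ) : IsParallelToHypocycloid 3 f := by
  refine ⟨fun φ => inner ℝ c (dirN φ) + inner ℝ u (dirN (3 * φ)),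
    isHypocycloidSupport_of_eq (n := 1) (c := c) one_pos hu fun φ => by norm_num, a, fun φ => ?_⟩
  rw [h, trigSum, inner_zero_left]
  ring

theorem isParallelToHypocycloid_five {f : ℝ → ℝ} {a : ℝ} {c v : Plane} (hv : v ≠ 0)
    (h : ∀ φ, f φ = trigSum a c 0 v φ) : IsParallelToHypocycloid 5 f := by
  refine ⟨fun φ => inner ℝ c (dirN φ) + inner ℝ v (dirN (5 * φ)),
    isHypocycloidSupport_of_eq (n := 2) (c := c) two_pos hv fun φ => by norm_num, a, fun φ => ?_⟩
  rw [h, trigSum, inner_zero_left]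
  ring

theorem eq_closedBall_of_supportFun_eq {K : Set Plane} (hK : IsStrictlyConvexC2 K) {a : ℝ}
    {c : Plane} (h : ∀ φ, supportFun K φ = trigSum a c 0 0 φ) :
    0 < a ∧ K = Metric.closedBall c a := by
  have h' : ∀ φ, supportFun K φ = inner ℝ c (dirN φ) + a := fun φ => by
    rw [h, trigSum, inner_zero_left, inner_zero_left]
    ring
  -- The gap at `τ = π` is the width, here `2a`.
  have ha : 0 < a := by
    have := supportGap_pos_of_pos hK.contDiff hK.radius_pos 0 Real.pi_pos le_rfl
    rw [supportGap, h', h', inner_dirN_add] at this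
    simp only [Real.cos_pi, Real.sin_pi] at this
    linarith
  refine ⟨ha, eq_of_supportFun_eq hK.nonempty hK.isCompact hK.convex
    (Metric.nonempty_closedBall.2 ha.le) (isCompact_closedBall c a) (convex_closedBall c a)
    fun φ => ?_⟩
  rw [h', supportFun_closedBall c ha.le]

theorem exists_eq_trigSum_iff {K : Set Plane} (hK : IsStrictlyConvexC2 K) :
    (∃ (a : ℝ) (c u v : Plane), ∀ φ, supportFun K φ = trigSum a c u v φ) ↔
      (∃ (c : Plane) (R : ℝ), 0 < R ∧ K = Metric.closedBall c R) ∨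
        IsParallelToHypocycloid 3 (supportFun K) ∨ IsParallelToHypocycloid 5 (supportFun K) ∨
        IsMinkowskiSum K := by
  constructor
  · rintro ⟨a, c, u, v, h⟩
    by_cases hu : u = 0
    · subst hu
      by_cases hv : v = 0
      · subst hv
        exact Or.inl ⟨c, a, eq_closedBall_of_supportFun_eq hK h⟩
      · exact Or.inr (Or.inr (Or.inl (isParallelToHypocycloid_five hv h)))
    · by_cases hv : v = 0
      · subst hv
        exact Or.inr (Or.inl (isParallelToHypocycloid_three hu h))
      -- Two summands suffice: a parallel curve of a Steiner curve, carrying the constant and the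
      -- translation, and a hypocycloid with five cusps centred at the origin. Neither has to bound
      -- a convex domain.
      · refine Or.inr (Or.inr (Or.inr ⟨1, ![trigSum a c u 0, trigSum 0 0 0 v], ?_, fun φ => ?_⟩))
        · intro i
          fin_cases i
          · exact Or.inr (Or.inl (isParallelToHypocycloid_three hu fun _ => rfl))
          · exact Or.inr (Or.inr (isParallelToHypocycloid_five hv fun _ => rfl))
        · rw [h, Fin.sum_univ_two]
          simp [trigSum]
  · rintro (⟨c, R, hR, rfl⟩ | h | h | h)
    · exact exists_eq_trigSum_of_closedBall c hR
    · exact exists_eq_trigSum_of_three h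
    · exact exists_eq_trigSum_of_five h
    · exact exists_eq_trigSum_of_isMinkowskiSum h

theorem widthDeficit_eq_visualBound_iff_exists {K : Set Plane} (hK : IsStrictlyConvexC2 K)
    (hw : HasConstantWidth K) : widthDeficit K = visualBound K ↔
      ∃ (a : ℝ) (c u v : Plane), ∀ φ, supportFun K φ = trigSum a c u v φ := by
  rw [widthDeficit_eq_visualBound_iff hK hw]
  constructor
  · exact fun h => exists_eq_trigSum hK.contDiff.continuous (supportFun_periodic K) h
      fun n hn hn0 => coeff_supportFun_eq_zero hK hw hn hn0
  · rintro ⟨a, c, u, v, h⟩ n hn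
    rw [show supportFun K = trigSum a c u v from funext h]
    exact coeff_trigSum a c u v hn

end HurwitzWidth

end

theorem mainTheorem4 (K : Set HurwitzWidth.Plane)
    (hK : HurwitzWidth.IsStrictlyConvexC2 K) (hw : HurwitzWidth.HasConstantWidth K) :
    MeasureTheory.IntegrableOn
        (fun P => HurwitzWidth.angleIntegrand (HurwitzWidth.visualAngle K P)) Kᶜ ∧
      HurwitzWidth.widthDeficit K ≥ HurwitzWidth.visualBound K ∧
      (HurwitzWidth.widthDeficit K ≠ 0 → 0 < HurwitzWidth.visualBound K) ∧
      (HurwitzWidth.widthDeficit K = 0 → HurwitzWidth.visualBound K = 0) ∧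
      (HurwitzWidth.widthDeficit K = HurwitzWidth.visualBound K ↔
        (∃ (c : HurwitzWidth.Plane) (R : ℝ), 0 < R ∧ K = Metric.closedBall c R) ∨
        HurwitzWidth.IsParallelToHypocycloid 3 (HurwitzWidth.supportFun K) ∨
        HurwitzWidth.IsParallelToHypocycloid 5 (HurwitzWidth.supportFun K) ∨
        HurwitzWidth.IsMinkowskiSum K) := by
  have hle := HurwitzWidth.visualBound_le_widthDeficit hK hw
  have hnn := HurwitzWidth.visualBound_nonneg hK hw
  refine ⟨(HurwitzWidth.angle_integral hK).1, hle, fun h => hnn.lt_of_ne' fun h0 => h ?_,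
    fun h => le_antisymm (h ▸ hle) hnn, ?_⟩
  · exact HurwitzWidth.widthDeficit_eq_zero_of_visualBound_eq_zero hK hw h0
  · rw [HurwitzWidth.widthDeficit_eq_visualBound_iff_exists hK hw,
      HurwitzWidth.exists_eq_trigSum_iff hK]
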